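/- **Theorem (Whitehead).** Let $\mathcal M$ be a simplicial model category, with enriched hom $\operatorname{map}(X,Y)$ and tensor $K\otimes X$, and let $[X,Y]$ denote the set of morphisms $X\to Y$ in the homotopy category $\mathrm{Ho}(\mathcal M)$. Let $\mathcal D$ be any collection of cofibrant objects of $\mathcal M$ and let $d$ be an integer. A map $g\colon A\to B$ of Kan complexes is a *$d$-equivalence* if $\pi_i(g)$ is bijective for $0\le i<d$ and surjective for $i=d\ge 0$, for all base points of $A$ (for $i=0$ this refers to the sets of connected components). A map $f\colon Y\to Z$ in $\mathcal M$ is a *$d$-equivalence* (with respect to $\mathcal D$) if for each $D\in\mathcal D$ the map $f_*\colon\operatorname{map}(D,Y^{\mathrm{fib}})\to\operatorname{map}(D,Z^{\mathrm{fib}})$, where $(-)^{\mathrm{fib}}$ is fibrant replacement, is a $d$-equivalence of simplicial sets. For an integer $n$ let $$\mathcal I_n=\{\partial\Delta^k\otimes D\to\Delta^k\otimes D\mid 0\le k\le n,\ D\in\mathcal D\}.$$ Write $\dim X\le n$ if the unique map $0\to X$ from the initial object is an $\mathcal I_n$-cell complex, i.e. a transfinite composition of pushouts of maps in $\mathcal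 I_n$, and write $\dim X<d$ if $\dim X\le n$ for some integer $n<d$. Let $X,Y,Z$ be objects of $\mathcal M$ and $f\colon Y\to Z$ a $d$-equivalence. If $\dim X\le d$, then the induced map $f_*\colon[X,Y]\to[X,Z]$ is surjective. If $\dim X<d$, then $f_*$ is a bijection. -/

import Mathlib

open CategoryTheory HomotopicalAlgebra Simplicial MonoidalCategory

universe w v u

noncomputable section

namespace SSet

/-- The map `π_n(A, a) ⟶ π_n(B, f a)` induced by a map `f : A ⟶ B` of simplicial sets, where
`π_n(A, a)` is the set of homotopy classes, relative to the boundary, of simplices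
`Δ[n] ⟶ A` that are constant with value `a` on `∂Δ[n]`. For Kan complexes this is the
usual combinatorial description of the homotopy groups. -/
def mapHomotopyClass {A B : SSet.{v}} (f : A ⟶ B) (n : ℕ) (a : A _⦋0⦌) :
    RelativeMorphism.HomotopyClass (boundary.{v} n) (Subcomplex.ofSimplex a)
        (const ⟨a, Subcomplex.mem_ofSimplex_obj a⟩) →
      RelativeMorphism.HomotopyClass (boundary.{v} n) (Subcomplex.ofSimplex (f.app _ a))
        (const ⟨f.app _ a, Subcomplex.mem_ofSimplex_obj _⟩) :=
  fun s ↦ s.postcomp (RelativeMorphism.ofSimplex₀ f a (f.app _ a) rfl) rfl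

/-- A map `f` of Kan complexes is a `d`-equivalence if `π_i(f)` is a bijection for `i < d` and
a surjection for `i = d`, for all base points in the source. The condition for `i = 0`
is stated on sets of connected components, so that it makes sense for an empty source.
For `d < 0` there is no condition. -/
structure IsDEquivalence {A B : SSet.{v}} (d : ℤ) (f : A ⟶ B) : Prop where
  surjective_π₀ : 0 ≤ d → Function.Surjective (mapπ₀ f)
  injective_π₀ : 0 < d → Function.Injective (mapπ₀ f)
  surjective_π : ∀ (i : ℕ), 1 ≤ i → (i : ℤ) ≤ d → ∀ a : A _⦋0⦌,
    Function.Surjective (mapHomotopyClass f i a)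
  injective_π : ∀ (i : ℕ), 1 ≤ i → (i : ℤ) < d → ∀ a : A _⦋0⦌,
    Function.Injective (mapHomotopyClass f i a)

/-- Kan fibrations: the right lifting property with respect to all horn inclusions. -/
abbrev kanFibrations : MorphismProperty SSet.{v} := modelCategoryQuillen.J.rlp

/-- Trivial Kan fibrations: the right lifting property with respect to all
boundary inclusions `∂Δ[n] ⟶ Δ[n]`. -/
abbrev trivialKanFibrations : MorphismProperty SSet.{v} := modelCategoryQuillen.I.rlp

end SSet

namespace SimplicialModel

open SimplicialCategory

section

variable {M : Type u} [Category.{v} M] [SimplicialCategory M]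

/-- Given `η : K ⟶ map(X, T)`, the induced map of simplicial sets
`map(T, Y) ⟶ map(X, Y)^K`. -/
def tensorComparison {K : SSet.{v}} {X T : M} (η : K ⟶ sHom X T) (Y : M) :
    sHom T Y ⟶ (ihom K).obj (sHom X Y) :=
  MonoidalClosed.curry (η ▷ sHom T Y ≫ sHomComp X T Y)

/-- Given `ε : K ⟶ map(P, Y)`, the induced map of simplicial sets
`map(X, P) ⟶ map(X, Y)^K`. -/
def cotensorComparison {K : SSet.{v}} {Y P : M} (ε : K ⟶ sHom P Y) (X : M) :
    sHom X P ⟶ (ihom K).obj (sHom X Y) :=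
  MonoidalClosed.curry ((β_ K (sHom X P)).hom ≫ sHom X P ◁ ε ≫ sHomComp X P Y)

/-- A tensor `K ⊗ X` of `X : M` by a simplicial set `K`:
`map(K ⊗ X, Y) ≅ map(X, Y)^K` for all `Y`. -/
structure Tensor (K : SSet.{v}) (X : M) where
  obj : M
  unit : K ⟶ sHom X obj
  isIso (Y : M) : IsIso (tensorComparison unit Y)

/-- A cotensor `Y^K` of `Y : M` by a simplicial set `K`:
`map(X, Y^K) ≅ map(X, Y)^K` for all `X`. -/
structure Cotensor (K : SSet.{v}) (Y : M) where
  obj : M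
  counit : K ⟶ sHom obj Y
  isIso (X : M) : IsIso (cotensorComparison counit X)

attribute [instance] Tensor.isIso Cotensor.isIso

/-- The morphism `K ⊗ X ⟶ Y` corresponding to `g : K ⟶ map(X, Y)`. -/
def Tensor.desc {K : SSet.{v}} {X : M} (T : Tensor K X) {Y : M} (g : K ⟶ sHom X Y) :
    T.obj ⟶ Y :=
  (eHomEquiv SSet.{v}).symm
    (MonoidalClosed.curry ((ρ_ K).hom ≫ g) ≫ inv (tensorComparison T.unit Y))

lemma eHomEquiv_tensorComparison {K : SSet.{v}} {X T : M} (η : K ⟶ sHom X T) {Y : M}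
    (f : T ⟶ Y) :
    eHomEquiv SSet.{v} f ≫ tensorComparison η Y =
      MonoidalClosed.curry ((ρ_ K).hom ≫ η ≫ eHomWhiskerLeft SSet.{v} X f) := by
  rw [tensorComparison, ← MonoidalClosed.curry_natural_left, eHomWhiskerLeft,
    whisker_exchange_assoc]
  simp

lemma Tensor.unit_desc {K : SSet.{v}} {X : M} (T : Tensor K X) {Y : M} (g : K ⟶ sHom X Y) :
    T.unit ≫ eHomWhiskerLeft SSet.{v} X (T.desc g) = g := by
  have h := eHomEquiv_tensorComparison T.unit (T.desc g)
  rw [Tensor.desc, Equiv.apply_symm_apply, Category.assoc, IsIso.inv_hom_id,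
    Category.comp_id] at h
  exact ((cancel_epi (ρ_ K).hom).1 (MonoidalClosed.curry_injective h)).symm

lemma Tensor.hom_ext {K : SSet.{v}} {X : M} (T : Tensor K X) {Y : M} {a b : T.obj ⟶ Y}
    (h : T.unit ≫ eHomWhiskerLeft SSet.{v} X a = T.unit ≫ eHomWhiskerLeft SSet.{v} X b) :
    a = b := by
  apply (eHomEquiv SSet.{v}).injective
  rw [← cancel_mono (tensorComparison T.unit Y), eHomEquiv_tensorComparison,
    eHomEquiv_tensorComparison, h]

/-- The morphism `φ ⊗ X : K ⊗ X ⟶ L ⊗ X` induced by `φ : K ⟶ L`. -/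
def Tensor.map {K L : SSet.{v}} {X : M} (S : Tensor K X) (T : Tensor L X) (φ : K ⟶ L) :
    S.obj ⟶ T.obj :=
  S.desc (φ ≫ T.unit)

end

/-- Simplicial model categories: model categories that are enriched, tensored and cotensored
over simplicial sets, such that for any cofibration `i : A ⟶ B` and any fibration
`p : X ⟶ Y`, the map `map(B, X) ⟶ map(A, X) ×_{map(A, Y)} map(B, Y)` is a Kan fibration,
which is trivial if `i` or `p` is a weak equivalence. -/
class SimplicialModelCategory (M : Type u) [Category.{v} M] [SimplicialCategory M]
    [ModelCategory M] : Prop where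
  exists_tensor (K : SSet.{v}) (X : M) : Nonempty (Tensor K X)
  exists_cotensor (K : SSet.{v}) (Y : M) : Nonempty (Cotensor K Y)
  fibration {A B X Y : M} (i : A ⟶ B) (p : X ⟶ Y) [Cofibration i] [Fibration p] :
    SSet.kanFibrations (Functor.PullbackObjObj.ofHasPullback (sHomFunctor M) i p).π
  trivialFibration_of_left {A B X Y : M} (i : A ⟶ B) (p : X ⟶ Y) [Cofibration i]
    [WeakEquivalence i] [Fibration p] :
    SSet.trivialKanFibrations (Functor.PullbackObjObj.ofHasPullback (sHomFunctor M) i p).π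
  trivialFibration_of_right {A B X Y : M} (i : A ⟶ B) (p : X ⟶ Y) [Cofibration i]
    [Fibration p] [WeakEquivalence p] :
    SSet.trivialKanFibrations (Functor.PullbackObjObj.ofHasPullback (sHomFunctor M) i p).π

variable {M : Type u} [Category.{v} M] [SimplicialCategory M] [ModelCategory M]

/-- A choice of the tensor `K ⊗ X`. -/
def tensor [SimplicialModelCategory M] (K : SSet.{v}) (X : M) : Tensor K X :=
  (SimplicialModelCategory.exists_tensor K X).some

/-- The maps `∂Δ[k] ⊗ D ⟶ Δ[k] ⊗ D` for `k ≤ n` and `D` in `𝒟`. -/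
inductive cells [SimplicialModelCategory M] (𝒟 : ObjectProperty M) (n : ℤ) :
    MorphismProperty M where
  | mk (k : ℕ) (hk : (k : ℤ) ≤ n) (D : M) (hD : 𝒟 D) :
    cells 𝒟 n ((tensor (∂Δ[k] : SSet.{v}) D).map (tensor Δ[k] D) ∂Δ[k].ι)

/-- `dim X ≤ n`: the map from the initial object to `X` is a transfinite composition
of pushouts of maps `∂Δ[k] ⊗ D ⟶ Δ[k] ⊗ D` with `k ≤ n` and `D` in `𝒟`. -/
def DimLE [SimplicialModelCategory M] (𝒟 : ObjectProperty M) (X : M) (n : ℤ) : Prop :=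
  MorphismProperty.transfiniteCompositions.{w} (cells 𝒟 n).pushouts (Limits.initial.to X)

/-- `dim X < d`. -/
def DimLT [SimplicialModelCategory M] (𝒟 : ObjectProperty M) (X : M) (d : ℤ) : Prop :=
  ∃ n < d, DimLE.{w} 𝒟 X n

/-- A map `f : Y ⟶ Z` is a `d`-equivalence with respect to `𝒟` if, for a fibrant
replacement `f' : Y' ⟶ Z'` of `f`, all the maps
`map(D, Y') ⟶ map(D, Z')` with `D` in `𝒟` are `d`-equivalences of simplicial sets. -/
def IsDEquivalence (𝒟 : ObjectProperty M) (d : ℤ) {Y Z : M} (f : Y ⟶ Z) : Prop :=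
  ∃ (Y' Z' : M) (i : Y ⟶ Y') (j : Z ⟶ Z') (f' : Y' ⟶ Z'),
    IsFibrant Y' ∧ IsFibrant Z' ∧ WeakEquivalence i ∧ WeakEquivalence j ∧
    f ≫ j = i ≫ f' ∧
    ∀ D, 𝒟 D → SSet.IsDEquivalence d (eHomWhiskerLeft SSet.{v} D f')

/-- The set `[X, Y]` of homotopy classes of maps: morphisms in the homotopy category,
i.e. in the localization of `M` at the weak equivalences. -/
abbrev HomotopyClasses (X Y : M) :=
  (weakEquivalences M).Q.obj X ⟶ (weakEquivalences M).Q.obj Y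

/-- The map `f_* : [X, Y] ⟶ [X, Z]` induced by `f : Y ⟶ Z`. -/
def HomotopyClasses.postcomp (X : M) {Y Z : M} (f : Y ⟶ Z) :
    HomotopyClasses X Y → HomotopyClasses X Z :=
  fun g ↦ g ≫ (weakEquivalences M).Q.map f

end SimplicialModel

end

/-! A fibrant replacement of `f` factors as a trivial cofibration `s` followed by a fibration `p`,
so `f` may be replaced by `p`. For `D` in `𝒟`, `map(D, p)` is a Kan fibration between Kan complexes,
and `map(D, s)` is the inclusion of a deformation retract whose composite with `map(D, p)` is a
`d`-equivalence. Deforming lifting problems into the retract shows that `map(D, p)` lifts against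
`∂Δ[k] ⟶ Δ[k]` for all `k ≤ d` (`SSet.IsDEquivalence.hasLiftingProperty`): injectivity on `π_{k-1}`
fills the sphere upstairs, and surjectivity on `π_k` corrects the filling
(`hasLift_comp_of_isDEquivalence`).

By the tensor and cotensor adjunctions, lifting `0 ⟶ X` against `p` with parameters in `∂Δ[m] ⟶
Δ[m]` reduces, cell by cell, to lifting the pushout-products of `∂Δ[k] ⟶ Δ[k]` and `∂Δ[m] ⟶ Δ[m]`
against `map(D, p)`. These are inclusions into simplicial sets of dimension `k + m`, so `n + m ≤ d`
suffices when `dim X ≤ n` (`DimLE.hasEnrichedLifting`). The case `m = 0` lifts maps `X ⟶ Z` and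
gives surjectivity; the case `m = 1` lifts homotopies and gives injectivity, at the cost of one
dimension. Since `X` is cofibrant, homotopy classes into fibrant objects are represented by maps,
and equality of classes by simplicial homotopies. -/

noncomputable section

/-! ### Homotopy lifting and extension for Kan fibrations and Kan complexes -/

namespace SSet

open modelCategoryQuillen Limits CartesianMonoidalCategory

/-- The inclusion of a vertex in `Δ[1]` is an anodyne extension. -/
lemma anodyneExtensions_const (ε : Fin 2) :
    anodyneExtensions.{v} (const (stdSimplex.obj₀Equiv.symm ε) : Δ[0] ⟶ Δ[1]) := by
  have key (i j : Fin 2) (hij : j ≠ i) : anodyneExtensions.{v} (stdSimplex.δ j : Δ[0] ⟶ Δ[1]) := by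
    intro E B p hp
    rw [← HomotopicalAlgebra.fibration_iff] at hp
    refine ⟨fun {t b} sq ↦ ?_⟩
    -- The horn `Λ[1, i]` is a single point, so its inclusion is the vertex `δ j` up to isomorphism.
    let t' : (Λ[1, i] : SSet) ⟶ E := stdSimplex.isTerminalObj₀.from _ ≫ t
    have sq' : CommSq t' Λ[1, i].ι p b := ⟨horn.hom_ext' fun k hk ↦ by
      obtain rfl : k = j := by omega
      rw [horn.ι_ι_assoc, ← sq.w]
      have : horn.ι i k hk ≫ stdSimplex.isTerminalObj₀.from _ = 𝟙 _ :=
        stdSimplex.isTerminalObj₀.hom_ext _ _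
      simp only [t', ← Category.assoc]
      rw [this]
      rfl⟩
    refine ⟨⟨⟨sq'.lift, ?_, sq'.fac_right⟩⟩⟩
    rw [← horn.ι_ι i j hij, Category.assoc, sq'.fac_left]
    have : horn.ι i j hij ≫ stdSimplex.isTerminalObj₀.from _ = 𝟙 _ :=
      stdSimplex.isTerminalObj₀.hom_ext _ _
    simp only [t', ← Category.assoc]
    rw [this]
    rfl
  fin_cases ε
  · exact stdSimplex.δ_one_eq_const ▸ key 0 1 (by simp)
  · exact stdSimplex.δ_zero_eq_const ▸ key 1 0 (by simp)

/-- The inclusion `X ⟶ X ⊗ Δ[1]` of an endpoint. -/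
abbrev ιEnd (ε : Fin 2) {X : SSet.{v}} : X ⟶ X ⊗ Δ[1] :=
  lift (𝟙 X) (const (stdSimplex.obj₀Equiv.symm ε))

/-- The relative homotopy lifting property of Kan fibrations. -/
lemma exists_homotopy_lift {A X E B : SSet.{v}} (i : A ⟶ X) [Mono i] (p : E ⟶ B) [Fibration p]
    (ε : Fin 2) (h : A ⊗ Δ[1] ⟶ E) (g : X ⊗ Δ[1] ⟶ B) (hg : h ≫ p = i ▷ _ ≫ g)
    (l : X ⟶ E) (hl : i ≫ l = ιEnd ε ≫ h) (hl' : l ≫ p = ιEnd ε ≫ g) :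
    ∃ H : X ⊗ Δ[1] ⟶ E, i ▷ _ ≫ H = h ∧ ιEnd ε ≫ H = l ∧ H ≫ p = g := by
  let j : (Δ[0] : SSet.{v}) ⟶ Δ[1] := const (stdSimplex.obj₀Equiv.symm ε)
  let s := Functor.PushoutObjObj.ofHasPushout (curriedTensor SSet.{v}) i j
  -- `l` and `h` together are a map on the pushout-product of `i` with an endpoint of `Δ[1]`, which
  -- is anodyne.
  have hs : anodyneExtensions s.ι :=
    anodyneExtensions_pushoutObjObjι s (anodyneExtensions_const ε)
  let t : s.pt ⟶ E := s.isPushout.desc (fst X Δ[0] ≫ l) h (by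
    change i ▷ Δ[0] ≫ fst X Δ[0] ≫ l = A ◁ j ≫ h
    rw [whiskerRight_fst_assoc, hl]
    rfl)
  have : HasLiftingProperty s.ι p := hs _ (by rwa [← HomotopicalAlgebra.fibration_iff])
  have sq : CommSq t s.ι p g := ⟨by
    apply s.isPushout.hom_ext
    · rw [Functor.PushoutObjObj.inl_ι_assoc, IsPushout.inl_desc_assoc]
      change (fst X Δ[0] ≫ l) ≫ p = X ◁ j ≫ g
      rw [Category.assoc, hl']
      rfl
    · rw [Functor.PushoutObjObj.inr_ι_assoc, IsPushout.inr_desc_assoc]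
      exact hg⟩
  have h₁ : s.inl ≫ t = fst X Δ[0] ≫ l := s.isPushout.inl_desc _ _ _
  have h₂ : s.inr ≫ t = h := s.isPushout.inr_desc _ _ _
  refine ⟨sq.lift, ?_, ?_, sq.fac_right⟩
  · rw [← sq.fac_left, Functor.PushoutObjObj.inr_ι_assoc] at h₂
    exact h₂
  · rw [← sq.fac_left, Functor.PushoutObjObj.inl_ι_assoc] at h₁
    have := (lift (𝟙 X) (const (stdSimplex.obj₀Equiv.symm 0)) : X ⟶ X ⊗ Δ[0]) ≫= h₁
    exact this

/-- The property that the square with top map `a` and bottom map `b` has a lift. -/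
def HasLift {A X E B : SSet.{v}} (i : A ⟶ X) (p : E ⟶ B) (a : A ⟶ E) (b : X ⟶ B) : Prop :=
  ∃ l : X ⟶ E, i ≫ l = a ∧ l ≫ p = b

/-- Extend the lift at one end over the whole homotopy of squares, then restrict to the other end.
This is how lifting problems are deformed into simpler ones below. -/
lemma hasLift_of_homotopy {A X E B : SSet.{v}} (i : A ⟶ X) [Mono i] (p : E ⟶ B) [Fibration p]
    (ε ε' : Fin 2) (h : A ⊗ Δ[1] ⟶ E) (g : X ⊗ Δ[1] ⟶ B) (hg : h ≫ p = i ▷ _ ≫ g)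
    (H : HasLift i p (ιEnd ε ≫ h) (ιEnd ε ≫ g)) :
    HasLift i p (ιEnd ε' ≫ h) (ιEnd ε' ≫ g) := by
  obtain ⟨l, hl, hl'⟩ := H
  obtain ⟨K, hK, -, hK'⟩ := exists_homotopy_lift i p ε h g hg l hl hl'
  refine ⟨ιEnd ε' ≫ K, ?_, by rw [Category.assoc, hK']⟩
  rw [← hK]
  rfl

/-- The homotopy extension property for maps to Kan complexes. -/
lemma exists_homotopy_extension {A X E : SSet.{v}} (i : A ⟶ X) [Mono i] [KanComplex E]
    (ε : Fin 2) (h : A ⊗ Δ[1] ⟶ E) (l : X ⟶ E) (hl : i ≫ l = ιEnd ε ≫ h) :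
    ∃ H : X ⊗ Δ[1] ⟶ E, i ▷ _ ≫ H = h ∧ ιEnd ε ≫ H = l := by
  obtain ⟨H, h₁, h₂, -⟩ := exists_homotopy_lift i (terminal.from E) ε h (terminal.from _)
    (by subsingleton) l hl (by subsingleton)
  exact ⟨H, h₁, h₂⟩

lemma exists_extension_of_homotopy {A X E : SSet.{v}} (i : A ⟶ X) [Mono i] [KanComplex E]
    (ε ε' : Fin 2) (h : A ⊗ Δ[1] ⟶ E) (H : ∃ l : X ⟶ E, i ≫ l = ιEnd ε ≫ h) :
    ∃ l : X ⟶ E, i ≫ l = ιEnd ε' ≫ h := by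
  obtain ⟨l, hl⟩ := H
  obtain ⟨K, hK, -⟩ := exists_homotopy_extension i ε h l hl
  exact ⟨ιEnd ε' ≫ K, by rw [← hK]; rfl⟩

/-- Lifting against inclusions of boundaries of simplices of dimension `< N` implies
lifting against inclusions in simplicial sets of dimension `< N`. -/
lemma hasLiftingProperty_of_hasDimensionLT {E B : SSet.{v}} (p : E ⟶ B) (N : ℕ)
    (hp : ∀ k < N, HasLiftingProperty (boundary.{v} k).ι p)
    {A Y : SSet.{v}} (i : A ⟶ Y) [Mono i] [Y.HasDimensionLT N] : HasLiftingProperty i p := by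
  let W : MorphismProperty SSet.{v} := (MorphismProperty.ofHoms (fun (_ : Unit) ↦ p)).llp
  have hW {K L : SSet.{v}} (j : K ⟶ L) : W j ↔ HasLiftingProperty j p :=
    ⟨fun h ↦ h _ ⟨⟨⟩⟩, fun h _ _ _ ⟨_⟩ ↦ h⟩
  rw [← hW]
  refine MorphismProperty.transfiniteCompositionsOfShape_le W ℕ _
    ⟨(relativeCellComplexOfMono i).toTransfiniteCompositionOfShape, fun d hd ↦ ?_⟩
  refine MorphismProperty.of_isPushout
    ((relativeCellComplexOfMono i).attachCells d hd).isPushout ?_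
  -- A cell of dimension `d` is a nondegenerate simplex of `Y`, whence `d < N`.
  have : ∀ c : relativeCellComplexOfMono.Cell i d, W (boundary.{v} d).ι := fun c ↦
    (hW _).2 (hp d (Y.dim_lt_of_nonDegenerate ⟨_, c.nonDegenerate⟩ N))
  exact MorphismProperty.colimMap (W := W) _ (fun ⟨c⟩ ↦ this c)

end SSet

/-! ### Contractions of simplices and horns, and spheres that bound -/

namespace SSet

open modelCategoryQuillen Limits CartesianMonoidalCategory Opposite

namespace stdSimplex

/-- The contraction of `Δ[n]` onto its vertex `0`. -/
def contraction (n : ℕ) : (Δ[n] : SSet.{v}) ⊗ Δ[1] ⟶ Δ[n] where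
  app m := ↾fun x ↦ objMk
    { toFun := fun i ↦ if asOrderHom x.2 i = 0 then 0 else asOrderHom x.1 i
      monotone' := fun i j hij ↦ by
        have h₁ := (asOrderHom x.1).monotone hij
        have h₂ := (asOrderHom x.2).monotone hij
        dsimp only
        by_cases h : asOrderHom x.2 i = 0
        · simp [h]
        · rw [if_neg h, if_neg (fun h' ↦ h (Fin.le_zero_iff.1 (h₂.trans_eq h')))]
          exact h₁ }
  naturality _ _ _ := rfl

lemma contraction_app_apply {n d : ℕ} (x : ((Δ[n] : SSet.{v}) ⊗ Δ[1] : SSet.{v}) _⦋d⦌)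
    (i : Fin (d + 1)) :
    ((contraction n).app _ x : Δ[n] _⦋d⦌) i =
      if (x.2 : Δ[1] _⦋d⦌) i = 0 then 0 else (x.1 : Δ[n] _⦋d⦌) i := rfl

lemma ιEnd_one_contraction (n : ℕ) : ιEnd 1 ≫ contraction.{v} n = 𝟙 _ := by
  ext ⟨⟨d⟩⟩ x i
  rfl

lemma ιEnd_zero_contraction (n : ℕ) :
    ιEnd 0 ≫ contraction.{v} n = SSet.const (obj₀Equiv.symm 0) := by
  ext ⟨⟨d⟩⟩ x i
  rfl

/-- The contraction adds at most the vertex `0` to the range of a simplex, while membership in the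
horn asks for a missing vertex other than `0`. -/
lemma contraction_mem_horn {n : ℕ} {m : SimplexCategoryᵒᵖ}
    (x : ((Δ[n] : SSet.{v}) ⊗ Δ[1] : SSet.{v}).obj m) (hx : x.1 ∈ (horn n 0).obj m) :
    (contraction n).app _ x ∈ (horn n 0).obj m := by
  obtain ⟨⟨d⟩⟩ := m
  rw [mem_horn_iff_notMem_range] at hx ⊢
  obtain ⟨j, hj, h⟩ := hx
  refine ⟨j, hj, ?_⟩
  rintro ⟨i, hi⟩
  rw [contraction_app_apply] at hi
  split_ifs at hi
  · exact hj hi.symm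
  · exact h ⟨i, hi⟩

lemma δ_zero_mem_horn {n : ℕ} {m : SimplexCategoryᵒᵖ} (x : (Δ[n] : SSet.{v}).obj m)
    (hx : x ∈ (boundary n).obj m) :
    (stdSimplex.δ (0 : Fin (n + 2))).app _ x ∈ (horn (n + 1) 0).obj m := by
  obtain ⟨⟨d⟩⟩ := m
  rw [mem_horn_iff_notMem_range]
  rw [mem_boundary_iff_notMem_range] at hx
  obtain ⟨j, hj⟩ := hx
  refine ⟨j.succ, Fin.succ_ne_zero _, ?_⟩
  rintro ⟨i, hi⟩
  exact hj ⟨i, Fin.succ_injective _ hi⟩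

end stdSimplex

namespace horn

/-- The contraction of the horn `Λ[n, 0]` onto the vertex `0`. -/
def contraction (n : ℕ) : (Λ[n, 0] : SSet.{v}) ⊗ Δ[1] ⟶ Λ[n, 0] :=
  Subcomplex.lift (Λ[n, 0].ι ▷ _ ≫ stdSimplex.contraction n) (by
    rintro m _ ⟨x, rfl⟩
    exact stdSimplex.contraction_mem_horn _ x.1.2)

lemma contraction_ι (n : ℕ) :
    contraction.{v} n ≫ Λ[n, 0].ι = Λ[n, 0].ι ▷ _ ≫ stdSimplex.contraction n := rfl

/-- The vertex `0` of the horn `Λ[n + 1, 0]`. -/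
def vertex (n : ℕ) : (Λ[n + 1, 0] : SSet.{v}) _⦋0⦌ :=
  ⟨stdSimplex.obj₀Equiv.symm 0, by
    rw [mem_horn_iff_notMem_range]
    refine ⟨Fin.last _, by simp, ?_⟩
    rintro ⟨i, hi⟩
    exact (Fin.last_pos (n := n)).ne hi⟩

lemma ιEnd_one_contraction (n : ℕ) : ιEnd 1 ≫ contraction.{v} n = 𝟙 _ := by
  rw [← cancel_mono (Subcomplex.ι _), Category.assoc, contraction_ι, Category.id_comp]
  exact Λ[n, 0].ι ≫= stdSimplex.ιEnd_one_contraction n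

lemma ιEnd_zero_contraction (n : ℕ) :
    ιEnd 0 ≫ contraction.{v} (n + 1) = SSet.const (vertex n) := by
  rw [← cancel_mono (Subcomplex.ι _), Category.assoc, contraction_ι, const_comp]
  exact Λ[n + 1, 0].ι ≫= stdSimplex.ιEnd_zero_contraction (n + 1)

lemma le_boundary (n : ℕ) : Λ[n, 0] ≤ boundary.{v} n := by
  rintro ⟨⟨d⟩⟩ x hx
  rw [mem_horn_iff_notMem_range] at hx
  rw [mem_boundary_iff_notMem_range]
  obtain ⟨j, -, hj⟩ := hx
  exact ⟨j, hj⟩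

/-- The inclusion of the horn `Λ[n, 0]` in the boundary. -/
abbrev toBoundary (n : ℕ) : (Λ[n, 0] : SSet.{v}) ⟶ ∂Δ[n] := Subcomplex.homOfLE (le_boundary n)

end horn

namespace boundary

/-- The inclusion of `∂Δ[n]` in `Λ[n + 1, 0]` induced by the face `0`. -/
def toHorn (n : ℕ) : (∂Δ[n] : SSet.{v}) ⟶ Λ[n + 1, 0] :=
  Subcomplex.lift (∂Δ[n].ι ≫ stdSimplex.δ 0) (by
    rintro m _ ⟨x, rfl⟩
    exact stdSimplex.δ_zero_mem_horn _ x.2)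

lemma toHorn_ι (n : ℕ) : toHorn.{v} n ≫ Λ[n + 1, 0].ι = ∂Δ[n].ι ≫ stdSimplex.δ 0 := rfl

lemma toHorn_toBoundary (n : ℕ) :
    toHorn.{v} n ≫ horn.toBoundary (n + 1) = ∂Δ[n].ι ≫ ι 0 := rfl

lemma face_sup_horn (n : ℕ) :
    stdSimplex.face.{v} {0}ᶜ ⊔ Λ[n + 1, 0] = boundary.{v} (n + 1) := by
  rw [boundary_eq_iSup, horn_eq_iSup, iSup_subtype]
  exact (iSup_split_single (fun i : Fin (n + 2) ↦ stdSimplex.face.{v} {i}ᶜ) 0).symm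

lemma mem_of_δ_zero_mem_horn {n : ℕ} {m : SimplexCategoryᵒᵖ} (x : (Δ[n] : SSet.{v}).obj m)
    (hx : (stdSimplex.δ (0 : Fin (n + 2))).app _ x ∈ (horn (n + 1) 0).obj m) :
    x ∈ (boundary n).obj m := by
  obtain ⟨⟨d⟩⟩ := m
  rw [mem_horn_iff_notMem_range] at hx
  rw [mem_boundary_iff_notMem_range]
  obtain ⟨j, hj, h⟩ := hx
  obtain ⟨j, rfl⟩ := Fin.exists_succ_eq.2 hj
  refine ⟨j, ?_⟩
  rintro ⟨i, rfl⟩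
  exact h ⟨i, rfl⟩

/-- The boundary of a simplex is obtained by gluing the face `0` and the horn `Λ[n + 1, 0]`. -/
lemma isPushout (n : ℕ) :
    IsPushout ∂Δ[n].ι (toHorn.{v} n) (ι 0) (horn.toBoundary (n + 1)) := by
  have sq : Subcomplex.BicartSq (stdSimplex.face.{v} {0}ᶜ ⊓ Λ[n + 1, 0]) (stdSimplex.face {0}ᶜ)
    Λ[n + 1, 0] ∂Δ[n + 1] := ⟨face_sup_horn n, rfl⟩
  let e := stdSimplex.faceSingletonComplIso.{v} (0 : Fin (n + 2))
  have he : e.inv ≫ stdSimplex.δ 0 = (stdSimplex.face {0}ᶜ).ι := by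
    rw [← stdSimplex.faceSingletonComplIso_hom_ι, Iso.inv_hom_id_assoc]
  let φ : (∂Δ[n] : SSet.{v}) ⟶ (stdSimplex.face.{v} {0}ᶜ ⊓ Λ[n + 1, 0] : Subcomplex _) :=
    Subcomplex.lift (∂Δ[n].ι ≫ stdSimplex.δ 0) (by
      rintro m _ ⟨x, rfl⟩
      exact ⟨(e.hom.app _ x.1).2, stdSimplex.δ_zero_mem_horn _ x.2⟩)
  let ψ : ((stdSimplex.face.{v} {0}ᶜ ⊓ Λ[n + 1, 0] : Subcomplex _) : SSet.{v}) ⟶ ∂Δ[n] :=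
    Subcomplex.lift (Subcomplex.homOfLE sq.le₁₂ ≫ e.inv) (by
      rintro m _ ⟨x, rfl⟩
      apply mem_of_δ_zero_mem_horn
      have := ConcreteCategory.congr_hom (congr_app he m) ⟨x.1, x.2.1⟩
      exact this ▸ x.2.2)
  have hφ : φ ≫ Subcomplex.homOfLE sq.le₁₂ = ∂Δ[n].ι ≫ e.hom := rfl
  have hψ : ψ ≫ ∂Δ[n].ι = Subcomplex.homOfLE sq.le₁₂ ≫ e.inv := rfl
  refine sq.isPushout.of_iso
    { hom := ψ
      inv := φ
      hom_inv_id := ?_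
      inv_hom_id := ?_ }
    e.symm (Iso.refl _) (Iso.refl _) ?_ ?_ ?_ ?_
  · rw [← cancel_mono (Subcomplex.homOfLE sq.le₁₂), Category.assoc, hφ, reassoc_of% hψ]
    simp
  · rw [← cancel_mono ∂Δ[n].ι, Category.assoc, hψ, reassoc_of% hφ]
    simp
  · exact hψ.symm
  · rw [← cancel_mono (Subcomplex.ι _), Category.assoc, Category.assoc, toHorn_ι]
    exact (Subcomplex.homOfLE sq.le₁₂ ≫= he).symm
  · rw [← cancel_mono (Subcomplex.ι _), Category.assoc, Category.assoc, ι_ι]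
    exact he.symm
  · rfl

lemma isPushout_whiskerRight (n : ℕ) (K : SSet.{v}) :
    IsPushout (∂Δ[n].ι ▷ K) (toHorn.{v} n ▷ K) (ι 0 ▷ K) (horn.toBoundary (n + 1) ▷ K) :=
  (isPushout n).map (tensorRight K)

end boundary

section

variable {F B : SSet.{v}} [KanComplex F]

/-- If two pointed simplices have the same homotopy class, then one extends to a simplex which
is constant on the opposite horn if and only if the other does. -/
lemma exists_extension_of_homotopyClass_eq {n : ℕ} {x : F _⦋0⦌} (s s' : F.PtSimplex n x)
    (h : s.homotopyClass = s'.homotopyClass)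
    (H : ∃ c : Δ[n + 1] ⟶ F, stdSimplex.δ 0 ≫ c = s.map ∧ Λ[n + 1, 0].ι ≫ c = const x) :
    ∃ c : Δ[n + 1] ⟶ F, stdSimplex.δ 0 ≫ c = s'.map ∧ Λ[n + 1, 0].ι ≫ c = const x := by
  have key (s s' : F.PtSimplex n x) (h : s.Homotopy s') (ε ε' : Fin 2)
      (H : ∃ c : Δ[n + 1] ⟶ F, stdSimplex.δ 0 ≫ c = ιEnd ε ≫ h.h ∧
        Λ[n + 1, 0].ι ≫ c = const x) :
      ∃ c : Δ[n + 1] ⟶ F, stdSimplex.δ 0 ≫ c = ιEnd ε' ≫ h.h ∧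
        Λ[n + 1, 0].ι ≫ c = const x := by
    obtain ⟨c, hc, hc'⟩ := H
    -- The homotopy on the face `0` and the constant homotopy on the horn glue to a homotopy on
    -- `∂Δ[n + 1]`, since the former is constant on the boundary of the face.
    obtain ⟨K, hK, hK'⟩ := (boundary.isPushout_whiskerRight n Δ[1]).exists_desc h.h (const x)
      (by rw [h.rel, comp_const]; rfl)
    obtain ⟨l, hl⟩ := exists_extension_of_homotopy ∂Δ[n + 1].ι ε ε' K ⟨c, by
      apply (boundary.isPushout n).hom_ext
      · rw [boundary.ι_ι_assoc, hc, ← hK]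
        rfl
      · exact hc'.trans (ιEnd ε ≫= hK'.symm)⟩
    refine ⟨l, ?_, ?_⟩
    · rw [← boundary.ι_ι, Category.assoc, hl, ← hK]
      rfl
    · have := horn.toBoundary (n + 1) ≫= hl
      exact this.trans (ιEnd ε' ≫= hK')
  -- Equal classes give only a zigzag of homotopies, so the claim is strengthened to an equivalence
  -- before the induction.
  have := Quot.eqvGen_exact h
  clear h
  suffices (∃ c : Δ[n + 1] ⟶ F, stdSimplex.δ 0 ≫ c = s.map ∧ Λ[n + 1, 0].ι ≫ c = const x) ↔
      (∃ c : Δ[n + 1] ⟶ F, stdSimplex.δ 0 ≫ c = s'.map ∧ Λ[n + 1, 0].ι ≫ c = const x) from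
    this.1 H
  clear H
  induction this with
  | rel s s' h =>
    obtain ⟨h⟩ := h
    rw [← h.h₀, ← h.h₁]
    exact ⟨key s s' h 0 1, key s s' h 1 0⟩
  | refl _ => rfl
  | symm _ _ _ h => exact h.symm
  | trans _ _ _ _ _ h h' => exact h.trans h'

/-- A sphere of dimension `n` in a Kan complex `F` bounds if its image by `f : F ⟶ B` does
and `f` is injective on homotopy classes of pointed `n`-simplices. -/
lemma exists_extension_of_injective [KanComplex B] (f : F ⟶ B) (n : ℕ)
    (hf : ∀ x : F _⦋0⦌, Function.Injective (mapHomotopyClass f n x))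
    (a : (∂Δ[n + 1] : SSet) ⟶ F) (b : Δ[n + 1] ⟶ B) (hab : a ≫ f = ∂Δ[n + 1].ι ≫ b) :
    ∃ c : Δ[n + 1] ⟶ F, ∂Δ[n + 1].ι ≫ c = a := by
  let j := horn.toBoundary.{v} (n + 1)
  let x : F _⦋0⦌ := (j ≫ a).app _ (horn.vertex n)
  -- Contracting the horn deforms `a` to a sphere `a'` that is constant on the horn, so that all its
  -- content lies in the face `0`. The filling `b` is deformed along with it.
  obtain ⟨K, hK, rfl⟩ := exists_homotopy_extension j 1 (horn.contraction (n + 1) ≫ j ≫ a) a (by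
    rw [← Category.assoc (ιEnd 1), horn.ιEnd_one_contraction, Category.id_comp])
  obtain ⟨G, hG, -⟩ := exists_homotopy_extension ∂Δ[n + 1].ι 1 (K ≫ f) b
    (by rw [← hab, Category.assoc])
  apply exists_extension_of_homotopy _ 0 1 K
  let a' := ιEnd 0 ≫ K
  let b' := ιEnd 0 ≫ G
  have ha' : j ≫ a' = const x := by
    have := ιEnd 0 ≫= hK
    rw [← Category.assoc (ιEnd 0) (horn.contraction _), horn.ιEnd_zero_contraction,
      const_comp] at this
    exact this
  have hab' : ∂Δ[n + 1].ι ≫ b' = a' ≫ f := by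
    have := ιEnd 0 ≫= hG
    exact this
  have hb' : Λ[n + 1, 0].ι ≫ b' = const (f.app _ x) := by
    rw [← const_comp, ← ha', Category.assoc, ← hab']
    rfl
  have hb₀ : b'.app _ (stdSimplex.obj₀Equiv.symm 0) = f.app _ x :=
    (ConcreteCategory.congr_hom (congr_app hb' _) (horn.vertex n)).trans (by simp [const])
  let s : F.PtSimplex n x :=
    { map := boundary.ι 0 ≫ a'
      comm := by
        rw [← reassoc_of% boundary.toHorn_toBoundary, ha']
        rfl }
  let o : F.PtSimplex n x := .const
  -- The filling `b'` kills the image of `s`: contract the face `0` inside `Δ[n + 1]` to the vertex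
  -- `0`. The boundary of that face stays in the horn, where `b'` is constant.
  have hs : mapHomotopyClass f n x o.homotopyClass = mapHomotopyClass f n x s.homotopyClass := by
    refine RelativeMorphism.Homotopy.eq
      { h := stdSimplex.δ 0 ▷ _ ≫ stdSimplex.contraction (n + 1) ≫ b'
        h₀ := ?_
        h₁ := ?_
        rel := ?_ }
    · have : ι₀ ≫ stdSimplex.contraction (n + 1) = const (stdSimplex.obj₀Equiv.symm 0) :=
        stdSimplex.ιEnd_zero_contraction (n + 1)
      rw [ι₀_comp_assoc, reassoc_of% this, const_comp, hb₀]
      exact (const_comp x f).symm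
    · have : ι₁ ≫ stdSimplex.contraction (n + 1) = 𝟙 _ :=
        stdSimplex.ιEnd_one_contraction (n + 1)
      rw [ι₁_comp_assoc, reassoc_of% this, ← boundary.ι_ι, Category.assoc, hab']
      rfl
    · have h₁ : boundary.toHorn n ▷ Δ[1] ≫ Λ[n + 1, 0].ι ▷ Δ[1] =
        ∂Δ[n].ι ▷ Δ[1] ≫ stdSimplex.δ 0 ▷ Δ[1] := rfl
      rw [← reassoc_of% h₁, ← reassoc_of% horn.contraction_ι, hb']
      rfl
  obtain ⟨c, hc, hc'⟩ := exists_extension_of_homotopyClass_eq o s (hf x hs)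
    ⟨const x, rfl, rfl⟩
  refine ⟨c, (boundary.isPushout n).hom_ext ?_ ?_⟩
  · rwa [boundary.ι_ι_assoc]
  · exact hc'.trans ha'.symm

end

end SSet

/-! ### From `d`-equivalences to lifting against boundary inclusions -/

namespace SSet

open modelCategoryQuillen Limits CartesianMonoidalCategory Opposite

lemma stdSimplex.app_obj₀Equiv_symm_zero {X : SSet.{v}} (t : Δ[1] ⟶ X) :
    t.app _ (stdSimplex.obj₀Equiv.symm 0) = X.δ 1 (yonedaEquiv t) := by
  rw [← stdSimplex.yonedaEquiv_δ_comp, stdSimplex.δ_one_eq_const, const_comp, yonedaEquiv_const]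

lemma stdSimplex.app_obj₀Equiv_symm_one {X : SSet.{v}} (t : Δ[1] ⟶ X) :
    t.app _ (stdSimplex.obj₀Equiv.symm 1) = X.δ 0 (yonedaEquiv t) := by
  rw [← stdSimplex.yonedaEquiv_δ_comp, stdSimplex.δ_zero_eq_const, const_comp, yonedaEquiv_const]

/-- A `0`-simplex of `X`, considered as a pointed `0`-simplex for an arbitrary base point. -/
def PtSimplex.ofVertex {X : SSet.{v}} (x y : X _⦋0⦌) : X.PtSimplex 0 x where
  map := const y
  comm := boundary.hom_ext₀

lemma PtSimplex.map_eq_const {X : SSet.{v}} {x : X _⦋0⦌} (s : X.PtSimplex 0 x) :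
    s.map = const (yonedaEquiv s.map) :=
  yonedaEquiv.injective (yonedaEquiv_const _).symm

/-- As `∂Δ[0]` is empty, an edge is a relative homotopy between its ends, and the base point plays
no role. -/
lemma PtSimplex.homotopyClass_ofVertex_eq {X : SSet.{v}} (x y y' : X _⦋0⦌)
    (h : π₀.mk y = π₀.mk y') :
    (ofVertex x y).homotopyClass = (ofVertex x y').homotopyClass := by
  rw [π₀.mk_eq_mk_iff] at h
  induction h with
  | rel y y' h =>
    obtain ⟨e⟩ := h
    refine RelativeMorphism.Homotopy.eq
      { h := snd _ _ ≫ yonedaEquiv.symm e.edge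
        h₀ := ?_
        h₁ := ?_
        rel := ?_ }
    · have : (yonedaEquiv.symm e.edge).app _ (stdSimplex.obj₀Equiv.symm 0) = y :=
        (stdSimplex.app_obj₀Equiv_symm_zero _).trans ((congrArg _
          (yonedaEquiv.apply_symm_apply e.edge)).trans e.src_eq)
      rw [ι₀_snd_assoc, const_comp]
      exact congrArg const this
    · have : (yonedaEquiv.symm e.edge).app _ (stdSimplex.obj₀Equiv.symm 1) = y' :=
        (stdSimplex.app_obj₀Equiv_symm_one _).trans ((congrArg _
          (yonedaEquiv.apply_symm_apply e.edge)).trans e.tgt_eq)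
      rw [ι₁_snd_assoc, const_comp]
      exact congrArg const this
    · ext m ⟨⟨x, hx⟩, _⟩
      simp at hx
  | refl _ => rfl
  | symm _ _ _ h => exact h.symm
  | trans _ _ _ _ _ h h' => exact h.trans h'

lemma PtSimplex.mk_eq_of_homotopyClass_eq {X : SSet.{v}} {x : X _⦋0⦌} (s s' : X.PtSimplex 0 x)
    (h : s.homotopyClass = s'.homotopyClass) :
    π₀.mk (yonedaEquiv s.map) = π₀.mk (yonedaEquiv s'.map) := by
  have := Quot.eqvGen_exact h
  clear h
  induction this with
  | rel s s' h =>
    obtain ⟨h⟩ := h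
    let t : Δ[1] ⟶ X := lift (stdSimplex.isTerminalObj₀.from _) (𝟙 _) ≫ h.h
    refine π₀.sound (Edge.mk (yonedaEquiv t) ?_ ?_)
    · have : const (stdSimplex.obj₀Equiv.symm 0) ≫ t = s.map := by
        rw [← h.h₀, ← Category.assoc]
        congr 1
        exact CartesianMonoidalCategory.hom_ext _ _
          (stdSimplex.isTerminalObj₀.hom_ext _ _) rfl
      rw [← stdSimplex.app_obj₀Equiv_symm_zero, ← this, const_comp, yonedaEquiv_const]
    · have : const (stdSimplex.obj₀Equiv.symm 1) ≫ t = s'.map := by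
        rw [← h.h₁, ← Category.assoc]
        congr 1
        exact CartesianMonoidalCategory.hom_ext _ _
          (stdSimplex.isTerminalObj₀.hom_ext _ _) rfl
      rw [← stdSimplex.app_obj₀Equiv_symm_one, ← this, const_comp, yonedaEquiv_const]
  | refl _ => rfl
  | symm _ _ _ h => exact h.symm
  | trans _ _ _ _ _ h h' => exact h.trans h'

lemma mapHomotopyClass_zero_injective {F B : SSet.{v}} (f : F ⟶ B) (x : F _⦋0⦌)
    (hf : Function.Injective (mapπ₀ f)) : Function.Injective (mapHomotopyClass f 0 x) := by
  rintro ⟨s⟩ ⟨s'⟩ h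
  have h' := PtSimplex.mk_eq_of_homotopyClass_eq _ _ h
  change mapπ₀ f (π₀.mk (yonedaEquiv s.map)) = mapπ₀ f (π₀.mk (yonedaEquiv s'.map)) at h'
  have := PtSimplex.homotopyClass_ofVertex_eq x _ _ (hf h')
  have hs (s : F.PtSimplex 0 x) : PtSimplex.ofVertex x (yonedaEquiv s.map) = s :=
    RelativeMorphism.ext (PtSimplex.map_eq_const s).symm
  rwa [hs, hs] at this

lemma mapHomotopyClass_zero_surjective {F B : SSet.{v}} (f : F ⟶ B) (x : F _⦋0⦌)
    (hf : Function.Surjective (mapπ₀ f)) : Function.Surjective (mapHomotopyClass f 0 x) := by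
  rintro ⟨s⟩
  obtain ⟨y, hy⟩ := hf (π₀.mk (yonedaEquiv s.map))
  induction y with
  | mk y =>
    refine ⟨(PtSimplex.ofVertex x y).homotopyClass, ?_⟩
    have := PtSimplex.homotopyClass_ofVertex_eq (f.app _ x) _ _ hy
    have hs : PtSimplex.ofVertex (f.app _ x) (yonedaEquiv s.map) = s :=
      RelativeMorphism.ext (PtSimplex.map_eq_const s).symm
    rw [hs] at this
    rw [← show s.homotopyClass = Quot.mk _ s from rfl, ← this]
    refine congr_arg RelativeMorphism.homotopyClass (RelativeMorphism.ext ?_)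
    exact const_comp _ _

/-- Degree `0`, which the definition states on `π₀`, is put in the same form as the other degrees.
-/
lemma IsDEquivalence.surjective {F B : SSet.{v}} {f : F ⟶ B} {d : ℤ} (hf : IsDEquivalence d f)
    (n : ℕ) (hn : (n : ℤ) ≤ d) (x : F _⦋0⦌) : Function.Surjective (mapHomotopyClass f n x) := by
  obtain _ | n := n
  · exact mapHomotopyClass_zero_surjective f x (hf.surjective_π₀ hn)
  · exact hf.surjective_π _ (by lia) hn x

lemma IsDEquivalence.injective {F B : SSet.{v}} {f : F ⟶ B} {d : ℤ} (hf : IsDEquivalence d f)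
    (n : ℕ) (hn : (n : ℤ) < d) (x : F _⦋0⦌) : Function.Injective (mapHomotopyClass f n x) := by
  obtain _ | n := n
  · exact mapHomotopyClass_zero_injective f x (hf.injective_π₀ hn)
  · exact hf.injective_π _ (by lia) hn x

section

variable {F E B : SSet.{v}} (s : F ⟶ E) (p : E ⟶ B) [Fibration p]

/-- Here `b` represents a class in `π_k(B)`, joined by homotopies relative to the boundary to the
image of some simplex `e` of `F`. That image lifts to `e ≫ s`, and lifts are carried along the
homotopies. -/
lemma hasLift_const_of_surjective (k : ℕ) (x : F _⦋0⦌)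
    (hx : Function.Surjective (mapHomotopyClass (s ≫ p) k x))
    (b : Δ[k] ⟶ B) (hb : ∂Δ[k].ι ≫ b = const ((s ≫ p).app _ x)) :
    HasLift ∂Δ[k].ι p (const (s.app _ x)) b := by
  let t : B.PtSimplex k ((s ≫ p).app _ x) := { map := b, comm := hb }
  obtain ⟨⟨e⟩, he⟩ := hx t.homotopyClass
  have he' := Quot.eqvGen_exact he
  suffices ∀ {t t' : B.PtSimplex k ((s ≫ p).app _ x)},
      Relation.EqvGen (fun f g ↦ Nonempty (RelativeMorphism.Homotopy f g)) t t' →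
      (HasLift ∂Δ[k].ι p (const (s.app _ x)) t.map ↔
        HasLift ∂Δ[k].ι p (const (s.app _ x)) t'.map) by
    refine (this he').1 ⟨e.map ≫ s, ?_, Category.assoc _ _ _⟩
    rw [← Category.assoc, e.comm, Category.assoc]
    exact const_comp _ _
  intro t t' h
  induction h with
  | rel t t' h =>
    obtain ⟨h⟩ := h
    have h₁ : (const (s.app _ x) : (∂Δ[k] : SSet) ⊗ Δ[1] ⟶ E) ≫ p = ∂Δ[k].ι ▷ _ ≫ h.h := by
      rw [h.rel, const_comp]
      rfl
    rw [← h.h₀, ← h.h₁]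
    exact ⟨hasLift_of_homotopy ∂Δ[k].ι p 0 1 _ h.h h₁,
      hasLift_of_homotopy ∂Δ[k].ι p 1 0 _ h.h h₁⟩
  | refl _ => rfl
  | symm _ _ _ h => exact h.symm
  | trans _ _ _ _ _ h h' => exact h.trans h'

variable [KanComplex F] [KanComplex B]

lemma hasLift_comp_of_isDEquivalence {d : ℤ} (hf : IsDEquivalence d (s ≫ p))
    (k : ℕ) (hk : (k : ℤ) ≤ d) (a : (∂Δ[k] : SSet) ⟶ F) (b : Δ[k] ⟶ B)
    (hab : a ≫ s ≫ p = ∂Δ[k].ι ≫ b) : HasLift ∂Δ[k].ι p (a ≫ s) b := by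
  obtain _ | n := k
  -- Surjectivity on `π₀` is used here only to supply a base point in `F`; any one will do.
  · obtain ⟨x, -⟩ := hf.surjective_π₀ hk (π₀.mk (yonedaEquiv b))
    induction x with
    | mk x =>
      obtain ⟨l, -, hl⟩ := hasLift_const_of_surjective s p 0 x (hf.surjective 0 hk x) b
        boundary.hom_ext₀
      exact ⟨l, boundary.hom_ext₀, hl⟩
  -- Since `a` bounds some `c`, contracting `c` to its vertex `0` reduces to a square with constant
  -- top map, where surjectivity in degree `n + 1` applies.
  · obtain ⟨c, rfl⟩ := exists_extension_of_injective (s ≫ p) n (hf.injective n (by lia)) a b hab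
    let x : F _⦋0⦌ := c.app _ (stdSimplex.obj₀Equiv.symm 0)
    let K := ∂Δ[n + 1].ι ▷ _ ≫ stdSimplex.contraction (n + 1) ≫ c
    have hK₀ : ιEnd 0 ≫ K = const x := by
      have : ιEnd 0 ≫ K = ∂Δ[n + 1].ι ≫ ιEnd 0 ≫ stdSimplex.contraction (n + 1) ≫ c := rfl
      rw [this, reassoc_of% stdSimplex.ιEnd_zero_contraction, const_comp]
      rfl
    have hK₁ : ιEnd 1 ≫ K = ∂Δ[n + 1].ι ≫ c := by
      have : ιEnd 1 ≫ K = ∂Δ[n + 1].ι ≫ ιEnd 1 ≫ stdSimplex.contraction (n + 1) ≫ c := rfl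
      rw [this, reassoc_of% stdSimplex.ιEnd_one_contraction]
    obtain ⟨G, hG, rfl⟩ := exists_homotopy_extension ∂Δ[n + 1].ι 1 (K ≫ s ≫ p) b
      (by rw [reassoc_of% hK₁, ← hab, Category.assoc])
    rw [← hK₁, Category.assoc]
    refine hasLift_of_homotopy _ _ 0 1 (K ≫ s) G (by rw [hG, Category.assoc]) ?_
    rw [reassoc_of% hK₀, const_comp]
    refine hasLift_const_of_surjective s p (n + 1) x (hf.surjective _ hk x) _ ?_
    rw [← const_comp, ← hK₀, Category.assoc, ← hG]
    rfl

/-- Let `p` be a Kan fibration whose restriction along a deformation retract `s` of the source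
is a `d`-equivalence of Kan complexes. Then `p` has the right lifting property with respect to
boundary inclusions of simplices of dimension at most `d`. -/
lemma IsDEquivalence.hasLiftingProperty (r : E ⟶ F) (H : E ⊗ Δ[1] ⟶ E) (ε ε' : Fin 2)
    (h₀ : ιEnd ε ≫ H = 𝟙 E) (h₁ : ιEnd ε' ≫ H = r ≫ s) {d : ℤ}
    (hf : IsDEquivalence d (s ≫ p)) (k : ℕ) (hk : (k : ℤ) ≤ d) :
    HasLiftingProperty ∂Δ[k].ι p := by
  refine ⟨fun {a b} sq ↦ ?_⟩
  have e₀ : ιEnd ε ≫ a ▷ _ ≫ H = a :=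
    (show ιEnd ε ≫ a ▷ _ ≫ H = a ≫ ιEnd ε ≫ H from rfl).trans (by rw [h₀, Category.comp_id])
  have e₁ : ιEnd ε' ≫ a ▷ _ ≫ H = (a ≫ r) ≫ s :=
    (show ιEnd ε' ≫ a ▷ _ ≫ H = a ≫ ιEnd ε' ≫ H from rfl).trans (by rw [h₁, Category.assoc])
  -- The retraction moves the square from end `ε` to one at end `ε'` whose top map factors through
  -- `s`.
  obtain ⟨G, hG, hb⟩ := exists_homotopy_extension ∂Δ[k].ι ε (a ▷ _ ≫ H ≫ p) b (by
    refine sq.w.symm.trans ((congrArg (· ≫ p) e₀).symm.trans ?_)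
    simp only [Category.assoc])
  have h := hasLift_of_homotopy ∂Δ[k].ι p ε' ε (a ▷ _ ≫ H) G
    (by rw [hG, Category.assoc]) (by
      rw [e₁]
      refine hasLift_comp_of_isDEquivalence s p hf k hk _ _ ?_
      rw [← Category.assoc, ← e₁, Category.assoc, Category.assoc, ← hG]
      rfl)
  rw [e₀, hb] at h
  obtain ⟨l, hl, hl'⟩ := h
  exact ⟨⟨⟨l, hl, hl'⟩⟩⟩

end

end SSet

/-! ### Enriched lifting problems via tensors and cotensors -/

namespace CategoryTheory.Functor.PullbackObjObj

open Opposite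

variable {C₁ C₂ C₃ : Type*} [Category* C₁] [Category* C₂] [Category* C₃]
  {G : C₁ᵒᵖ ⥤ C₃ ⥤ C₂} {A B : C₁} {i : A ⟶ B} {X Y : C₃} {p : X ⟶ Y}

lemma exists_lift_of_hasLiftingProperty (P : G.PullbackObjObj i p) {K L : C₂} {j : K ⟶ L}
    (_ : HasLiftingProperty j P.π) (u : K ⟶ (G.obj (op B)).obj X) (v : L ⟶ (G.obj (op A)).obj X)
    (w : L ⟶ (G.obj (op B)).obj Y) (h₁ : u ≫ (G.map i.op).app X = j ≫ v)
    (h₂ : u ≫ (G.obj (op B)).map p = j ≫ w)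
    (h₃ : v ≫ (G.obj (op A)).map p = w ≫ (G.map i.op).app Y) :
    ∃ l : L ⟶ (G.obj (op B)).obj X, j ≫ l = u ∧ l ≫ (G.map i.op).app X = v ∧
      l ≫ (G.obj (op B)).map p = w := by
  have sq : CommSq u j P.π (P.isPullback.lift v w h₃) :=
    ⟨P.hom_ext (by simpa) (by simpa)⟩
  refine ⟨sq.lift, sq.fac_left, ?_, ?_⟩
  · rw [← P.π_fst, sq.fac_right_assoc, P.isPullback.lift_fst]
  · rw [← P.π_snd, sq.fac_right_assoc, P.isPullback.lift_snd]

end CategoryTheory.Functor.PullbackObjObj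

namespace SimplicialModel

open SimplicialCategory SSet Limits Opposite

section

variable {M : Type u} [Category.{v} M] [SimplicialCategory M]

/-- The enriched composition is dinatural in the middle object. -/
lemma eHomWhiskerLeft_whiskerRight_comp (X : M) {Y Y' : M} (f : Y ⟶ Y') (Z : M) :
    eHomWhiskerLeft SSet.{v} X f ▷ sHom Y' Z ≫ sHomComp X Y' Z =
      sHom X Y ◁ eHomWhiskerRight SSet.{v} f Z ≫ sHomComp X Y Z := by
  dsimp [eHomWhiskerLeft, eHomWhiskerRight]
  simp only [MonoidalCategory.whiskerLeft_comp, comp_whiskerRight, Category.assoc]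
  rw [← e_assoc' SSet.{v} X Y Y' Z]
  simp

/-- Maps `B ⟶ map(K ⊗ X, Y)` identify to maps `K ⊗ B ⟶ map(X, Y)`. -/
def Tensor.homEquiv {K : SSet.{v}} {X : M} (T : Tensor K X) (B : SSet.{v}) (Y : M) :
    (B ⟶ sHom T.obj Y) ≃ (K ⊗ B ⟶ sHom X Y) where
  toFun g := T.unit ▷ B ≫ sHom X T.obj ◁ g ≫ sHomComp X T.obj Y
  invFun h := MonoidalClosed.curry h ≫ inv (tensorComparison T.unit Y)
  left_inv g := by
    dsimp only
    rw [IsIso.comp_inv_eq, tensorComparison, ← MonoidalClosed.curry_natural_left,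
      whisker_exchange_assoc]
  right_inv h := by
    apply MonoidalClosed.curry_injective
    dsimp only
    rw [← whisker_exchange_assoc, MonoidalClosed.curry_natural_left, ← tensorComparison,
      Category.assoc, IsIso.inv_hom_id, Category.comp_id]

namespace Tensor

variable {K L : SSet.{v}} {X : M} (S : Tensor K X) (T : Tensor L X) {B B' : SSet.{v}} {Y Y' : M}

lemma homEquiv_comp (a : B' ⟶ B) (g : B ⟶ sHom T.obj Y) :
    T.homEquiv B' Y (a ≫ g) = L ◁ a ≫ T.homEquiv B Y g := by
  simp [homEquiv, whisker_exchange_assoc]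

lemma homEquiv_comp_eHomWhiskerLeft (g : B ⟶ sHom T.obj Y) (p : Y ⟶ Y') :
    T.homEquiv B Y' (g ≫ eHomWhiskerLeft SSet.{v} _ p) =
      T.homEquiv B Y g ≫ eHomWhiskerLeft SSet.{v} _ p := by
  simp [homEquiv, eComp_eHomWhiskerLeft]

lemma homEquiv_comp_eHomWhiskerRight_map (g : B ⟶ sHom T.obj Y) (φ : K ⟶ L) :
    S.homEquiv B Y (g ≫ eHomWhiskerRight SSet.{v} (S.map T φ) Y) =
      φ ▷ B ≫ T.homEquiv B Y g := by
  dsimp [homEquiv]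
  rw [MonoidalCategory.whiskerLeft_comp_assoc, ← eHomWhiskerLeft_whiskerRight_comp,
    whisker_exchange_assoc, ← comp_whiskerRight_assoc, map, unit_desc, comp_whiskerRight_assoc]

end Tensor

namespace Cotensor

variable {K L : SSet.{v}} {X Y : M}

lemma eHomEquiv_cotensorComparison {P : M} (ε : K ⟶ sHom P Y) (f : X ⟶ P) :
    eHomEquiv SSet.{v} f ≫ cotensorComparison ε X =
      MonoidalClosed.curry ((ρ_ K).hom ≫ ε ≫ eHomWhiskerRight SSet.{v} f Y) := by
  rw [cotensorComparison, ← MonoidalClosed.curry_natural_left, eHomWhiskerRight]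
  congr 1

/-- Maps `X ⟶ Y^K` identify to maps `K ⟶ map(X, Y)`. -/
def homEquiv (P : Cotensor K Y) (X : M) : (X ⟶ P.obj) ≃ (K ⟶ sHom X Y) where
  toFun f := P.counit ≫ eHomWhiskerRight SSet.{v} f Y
  invFun g := (eHomEquiv SSet.{v}).symm
    (MonoidalClosed.curry ((ρ_ K).hom ≫ g) ≫ inv (cotensorComparison P.counit X))
  left_inv f := by
    dsimp only
    rw [← eHomEquiv_cotensorComparison, Category.assoc, IsIso.hom_inv_id, Category.comp_id,
      Equiv.symm_apply_apply]
  right_inv g := by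
    rw [← cancel_epi (ρ_ K).hom]
    apply MonoidalClosed.curry_injective
    rw [← eHomEquiv_cotensorComparison, Equiv.apply_symm_apply, Category.assoc,
      IsIso.inv_hom_id, Category.comp_id]

lemma homEquiv_comp (P : Cotensor K Y) {X' : M} (a : X' ⟶ X) (f : X ⟶ P.obj) :
    P.homEquiv X' (a ≫ f) = P.homEquiv X f ≫ eHomWhiskerRight SSet.{v} a Y := by
  simp [homEquiv]

/-- The map `Y^L ⟶ Y^K` induced by `j : K ⟶ L`. -/
def pre (P : Cotensor K Y) (Q : Cotensor L Y) (j : K ⟶ L) : Q.obj ⟶ P.obj :=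
  (P.homEquiv _).symm (j ≫ Q.counit)

lemma homEquiv_comp_pre (P : Cotensor K Y) (Q : Cotensor L Y) (j : K ⟶ L) (f : X ⟶ Q.obj) :
    P.homEquiv X (f ≫ P.pre Q j) = j ≫ Q.homEquiv X f := by
  rw [homEquiv_comp, pre, Equiv.apply_symm_apply, Category.assoc]
  rfl

/-- The map `Y^K ⟶ Z^K` induced by `p : Y ⟶ Z`. -/
def post {Z : M} (Q : Cotensor K Y) (P : Cotensor K Z) (p : Y ⟶ Z) : Q.obj ⟶ P.obj :=
  (P.homEquiv _).symm (Q.counit ≫ eHomWhiskerLeft SSet.{v} _ p)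

lemma homEquiv_comp_post {Z : M} (Q : Cotensor K Y) (P : Cotensor K Z) (p : Y ⟶ Z)
    (f : X ⟶ Q.obj) :
    P.homEquiv X (f ≫ Q.post P p) = Q.homEquiv X f ≫ eHomWhiskerLeft SSet.{v} X p := by
  rw [homEquiv_comp, post, Equiv.apply_symm_apply, Category.assoc, eHom_whisker_exchange,
    ← Category.assoc]
  rfl

end Cotensor

/-- The lifting property of the map
`map(B, X) ⟶ map(A, X) ×_{map(A, Y)} map(B, Y)` with respect to `j`. -/
def HasEnrichedLifting {K L : SSet.{v}} {A B X Y : M} (j : K ⟶ L) (i : A ⟶ B) (p : X ⟶ Y) :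
    Prop :=
  ∀ (u : K ⟶ sHom B X) (v : L ⟶ sHom A X) (w : L ⟶ sHom B Y),
    u ≫ eHomWhiskerRight SSet.{v} i X = j ≫ v → u ≫ eHomWhiskerLeft SSet.{v} B p = j ≫ w →
    v ≫ eHomWhiskerLeft SSet.{v} A p = w ≫ eHomWhiskerRight SSet.{v} i Y →
    ∃ l : L ⟶ sHom B X, j ≫ l = u ∧ l ≫ eHomWhiskerRight SSet.{v} i X = v ∧
      l ≫ eHomWhiskerLeft SSet.{v} B p = w

section

variable {K L : SSet.{v}} {A B X Y : M} (j : K ⟶ L) (i : A ⟶ B) (p : X ⟶ Y)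

lemma hasEnrichedLifting_of_hasLiftingProperty
    (h : HasLiftingProperty j (Functor.PullbackObjObj.ofHasPullback (sHomFunctor M) i p).π) :
    HasEnrichedLifting j i p := by
  intro u v w h₁ h₂ h₃
  exact Functor.PullbackObjObj.exists_lift_of_hasLiftingProperty _ h u v w h₁ h₂ h₃

variable (XL : Cotensor L X) (XK : Cotensor K X) (YL : Cotensor L Y) (YK : Cotensor K Y)

lemma Cotensor.pre_post :
    XK.pre XL j ≫ XK.post YK p = XL.post YL p ≫ YK.pre YL j := by
  apply (YK.homEquiv _).injective
  rw [homEquiv_comp_post, homEquiv_comp_pre, ← Category.id_comp (XK.pre XL j), homEquiv_comp_pre,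
    ← Category.id_comp (XL.post YL p), homEquiv_comp_post, Category.assoc]

variable [HasPullback (XK.post YK p) (YK.pre YL j)]

/-- The map `X^L ⟶ X^K ×_{Y^K} Y^L`. -/
def Cotensor.pullbackLift : XL.obj ⟶ pullback (XK.post YK p) (YK.pre YL j) :=
  pullback.lift (XK.pre XL j) (XL.post YL p) (Cotensor.pre_post j p XL XK YL YK)

lemma Cotensor.pullbackLift_fst :
    pullbackLift j p XL XK YL YK ≫ pullback.fst _ _ = XK.pre XL j :=
  pullback.lift_fst _ _ _

lemma Cotensor.pullbackLift_snd :
    pullbackLift j p XL XK YL YK ≫ pullback.snd _ _ = XL.post YL p :=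
  pullback.lift_snd _ _ _

/-- Transposing along the cotensor adjunctions turns `i` into the left map of an ordinary lifting
problem, so the property passes to cell complexes in the variable `i`. -/
lemma hasEnrichedLifting_iff :
    HasEnrichedLifting j i p ↔
      HasLiftingProperty i (Cotensor.pullbackLift j p XL XK YL YK) := by
  constructor
  · refine fun H ↦ ⟨fun {a b} sq ↦ ?_⟩
    have sq₁ : a ≫ XK.pre XL j = i ≫ b ≫ pullback.fst _ _ := by
      rw [← sq.w_assoc, Cotensor.pullbackLift_fst]
    have sq₂ : a ≫ XL.post YL p = i ≫ b ≫ pullback.snd _ _ := by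
      rw [← sq.w_assoc, Cotensor.pullbackLift_snd]
    have hb : (b ≫ pullback.fst _ _) ≫ XK.post YK p = (b ≫ pullback.snd _ _) ≫ YK.pre YL j := by
      simp [pullback.condition]
    obtain ⟨l, h₁, h₂, h₃⟩ := H (XK.homEquiv _ (b ≫ pullback.fst _ _)) (XL.homEquiv _ a)
      (YL.homEquiv _ (b ≫ pullback.snd _ _))
      (by rw [← Cotensor.homEquiv_comp, ← sq₁, Cotensor.homEquiv_comp_pre])
      (by rw [← Cotensor.homEquiv_comp_post, hb, Cotensor.homEquiv_comp_pre])
      (by rw [← Cotensor.homEquiv_comp, ← sq₂, Cotensor.homEquiv_comp_post])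
    obtain ⟨l, rfl⟩ := (XL.homEquiv _).surjective l
    rw [← Cotensor.homEquiv_comp_pre, EmbeddingLike.apply_eq_iff_eq] at h₁
    rw [← Cotensor.homEquiv_comp, EmbeddingLike.apply_eq_iff_eq] at h₂
    rw [← Cotensor.homEquiv_comp_post, EmbeddingLike.apply_eq_iff_eq] at h₃
    refine ⟨⟨⟨l, h₂, pullback.hom_ext ?_ ?_⟩⟩⟩
    · rw [Category.assoc, Cotensor.pullbackLift_fst, h₁]
    · rw [Category.assoc, Cotensor.pullbackLift_snd, h₃]
  · intro H u v w h₁ h₂ h₃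
    obtain ⟨u, rfl⟩ := (XK.homEquiv _).surjective u
    obtain ⟨v, rfl⟩ := (XL.homEquiv _).surjective v
    obtain ⟨w, rfl⟩ := (YL.homEquiv _).surjective w
    rw [← Cotensor.homEquiv_comp_pre, ← Cotensor.homEquiv_comp, EmbeddingLike.apply_eq_iff_eq] at h₁
    rw [← Cotensor.homEquiv_comp_pre, ← Cotensor.homEquiv_comp_post,
      EmbeddingLike.apply_eq_iff_eq] at h₂
    rw [← Cotensor.homEquiv_comp_post, ← Cotensor.homEquiv_comp,
      EmbeddingLike.apply_eq_iff_eq] at h₃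
    have sq : CommSq v i (Cotensor.pullbackLift j p XL XK YL YK) (pullback.lift u w h₂) := by
      refine ⟨pullback.hom_ext ?_ ?_⟩
      · rw [Category.assoc, Category.assoc, Cotensor.pullbackLift_fst,
          pullback.lift_fst, h₁]
      · rw [Category.assoc, Category.assoc, Cotensor.pullbackLift_snd,
          pullback.lift_snd, h₃]
    refine ⟨XL.homEquiv _ sq.lift, ?_, ?_, ?_⟩
    · have := sq.fac_right =≫ pullback.fst _ _
      rw [Category.assoc, pullback.lift_fst, Cotensor.pullbackLift_fst] at this
      rw [← Cotensor.homEquiv_comp_pre, this]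
    · rw [← Cotensor.homEquiv_comp, sq.fac_left]
    · have := sq.fac_right =≫ pullback.snd _ _
      rw [Category.assoc, pullback.lift_snd, Cotensor.pullbackLift_snd] at this
      rw [← Cotensor.homEquiv_comp_post, this]

end

end

end SimplicialModel

/-! ### Constant maps and special cases of enriched lifting -/

namespace SimplicialModel

open SimplicialCategory SSet Limits Opposite CartesianMonoidalCategory

section

variable {M : Type u} [Category.{v} M] [SimplicialCategory M]

/-- Such maps correspond to maps from the initial object to `Y^K`. -/
lemma Cotensor.subsingleton {K : SSet.{v}} {Y : M} (P : Cotensor K Y) [HasInitial M] :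
    Subsingleton (K ⟶ sHom (⊥_ M) Y) :=
  (P.homEquiv _).symm.injective.subsingleton

lemma Tensor.subsingleton {K : SSet.{v}} {X : M} (T : Tensor K X) [HasTerminal M] :
    Subsingleton (K ⟶ sHom X (⊤_ M)) where
  allEq a b := by
    rw [← T.unit_desc a, ← T.unit_desc b, Subsingleton.elim (T.desc a) (T.desc b)]

/-- The constant map `K ⟶ map(X, Y)` with value `f`. -/
def constHom (K : SSet.{v}) {X Y : M} (f : X ⟶ Y) : K ⟶ sHom X Y :=
  toUnit K ≫ eHomEquiv SSet.{v} f

section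

variable {K L : SSet.{v}} {X Y Z : M}

@[simp]
lemma comp_constHom (φ : K ⟶ L) (f : X ⟶ Y) : φ ≫ constHom L f = constHom K f := by
  simp [constHom]

lemma eHomEquiv_comp_eHomWhiskerLeft (f : X ⟶ Y) (g : Y ⟶ Z) :
    eHomEquiv SSet.{v} f ≫ eHomWhiskerLeft SSet.{v} X g = eHomEquiv SSet.{v} (f ≫ g) := by
  rw [eHomEquiv_comp, eHomWhiskerLeft, rightUnitor_inv_naturality_assoc,
    MonoidalCategory.tensorHom_def, unitors_inv_equal]
  simp

lemma eHomEquiv_comp_eHomWhiskerRight (f : X ⟶ Y) (g : Y ⟶ Z) :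
    eHomEquiv SSet.{v} g ≫ eHomWhiskerRight SSet.{v} f Z = eHomEquiv SSet.{v} (f ≫ g) := by
  rw [eHomEquiv_comp, eHomWhiskerRight, leftUnitor_inv_naturality_assoc,
    tensorHom_def']
  simp

@[simp]
lemma constHom_eHomWhiskerLeft (f : X ⟶ Y) (g : Y ⟶ Z) :
    constHom K f ≫ eHomWhiskerLeft SSet.{v} X g = constHom K (f ≫ g) := by
  simp [constHom, eHomEquiv_comp_eHomWhiskerLeft]

@[simp]
lemma constHom_eHomWhiskerRight (f : X ⟶ Y) (g : Y ⟶ Z) :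
    constHom K g ≫ eHomWhiskerRight SSet.{v} f Z = constHom K (f ≫ g) := by
  simp [constHom, eHomEquiv_comp_eHomWhiskerRight]

lemma constHom_bijective : Function.Bijective (constHom Δ[0] : (X ⟶ Y) → _) := by
  let e : (Δ[0] : SSet.{v}) ≅ 𝟙_ _ :=
    stdSimplex.isTerminalObj₀.uniqueUpToIso isTerminalTensorUnit
  have he : e.hom = toUnit _ := by subsingleton
  constructor
  · intro f g h
    rwa [constHom, constHom, ← he, cancel_epi, EmbeddingLike.apply_eq_iff_eq] at h
  · intro h
    refine ⟨(eHomEquiv SSet.{v}).symm (e.inv ≫ h), ?_⟩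
    rw [constHom, ← he, Equiv.apply_symm_apply, e.hom_inv_id_assoc]

lemma exists_constHom_eq (h : Δ[0] ⟶ sHom X Y) : ∃ f, constHom Δ[0] f = h :=
  constHom_bijective.2 h

end

/-- The homotopy on `map(D, X)` induced by `h : Δ[1] ⟶ map(X, X)` has endpoints induced by
those of `h`. -/
lemma ιEnd_whiskerLeft_sHomComp {X : M} {f : X ⟶ X} (h : Δ[1] ⟶ sHom X X) (ε : Fin 2)
    (hf : const (stdSimplex.obj₀Equiv.symm ε) ≫ h = constHom Δ[0] f) (D : M) :
    ιEnd ε ≫ sHom D X ◁ h ≫ sHomComp D X X = eHomWhiskerLeft SSet.{v} D f := by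
  have h₁ : (const (stdSimplex.obj₀Equiv.symm ε) : sHom D X ⟶ Δ[1]) ≫ h = constHom _ f := by
    rw [← comp_constHom (stdSimplex.isTerminalObj₀.from (sHom D X)), ← hf]
    rfl
  rw [eHomWhiskerLeft, ← Category.assoc, ← Category.assoc (ρ_ _).inv]
  congr 1
  rw [ιEnd, lift_whiskerLeft, h₁, constHom, ← lift_whiskerLeft]
  congr 1

section

variable {K L : SSet.{v}} {A B X Y : M} {j : K ⟶ L} {i : A ⟶ B} {p : X ⟶ Y}

lemma HasEnrichedLifting.hasLiftingProperty_eHomWhiskerLeft [HasInitial M]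
    (XL : Cotensor L X) (XK : Cotensor K X) (YL : Cotensor L Y)
    (h : HasEnrichedLifting j (initial.to B) p) :
    HasLiftingProperty j (eHomWhiskerLeft SSet.{v} B p) where
  sq_hasLift {u w} sq := by
    have := XL.subsingleton
    have := XK.subsingleton
    have := YL.subsingleton
    obtain ⟨l, h₁, -, h₂⟩ := h u (constHom _ (initial.to X)) w (by subsingleton) sq.w
      (by subsingleton)
    exact ⟨⟨⟨l, h₁, h₂⟩⟩⟩

lemma HasEnrichedLifting.hasLiftingProperty_eHomWhiskerRight [HasTerminal M]
    (LA : Tensor L A) (LB : Tensor L B) (KB : Tensor K B)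
    (h : HasEnrichedLifting j i (terminal.from X)) :
    HasLiftingProperty j (eHomWhiskerRight SSet.{v} i X) where
  sq_hasLift {u v} sq := by
    have := LA.subsingleton
    have := LB.subsingleton
    have := KB.subsingleton
    obtain ⟨l, h₁, h₂, -⟩ := h u v (constHom _ (terminal.from B)) sq.w (by subsingleton)
      (by subsingleton)
    exact ⟨⟨⟨l, h₁, h₂⟩⟩⟩

/-- With `∂Δ[0]` empty and `Δ[0]` a point, the enriched problem has no parameters left. -/
lemma HasEnrichedLifting.hasLiftingProperty
    (h : HasEnrichedLifting (boundary.{v} 0).ι i p) : HasLiftingProperty i p where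
  sq_hasLift {a b} sq := by
    have hI : IsInitial (∂Δ[0] : SSet.{v}) := 
      isInitialOfNotNonempty ((notNonempty_iff_hasDimensionLT_zero _).2 inferInstance)
    obtain ⟨l, -, h₁, h₂⟩ := h (hI.to _) (constHom _ a) (constHom _ b)
      boundary.hom_ext₀ boundary.hom_ext₀ (by simp [sq.w])
    obtain ⟨l, rfl⟩ := exists_constHom_eq l
    rw [constHom_eHomWhiskerRight] at h₁
    rw [constHom_eHomWhiskerLeft] at h₂
    exact ⟨⟨⟨l, constHom_bijective.1 h₁, constHom_bijective.1 h₂⟩⟩⟩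

end

/-- By the tensor adjunction, the data `u` and `v` glue to a map on the pushout-product of the two
inclusions, and `w` becomes a map on `K ⊗ L`. -/
lemma hasEnrichedLifting_map {K L : SSet.{v}} {A : K.Subcomplex} {B : L.Subcomplex} {D X Y : M}
    {p : X ⟶ Y} (S : Tensor A D) (T : Tensor K D)
    (h : HasLiftingProperty (A.unionProd B).ι (eHomWhiskerLeft SSet.{v} D p)) :
    HasEnrichedLifting B.ι (S.map T A.ι) p := by
  intro u v w h₁ h₂ h₃
  let s := Subcomplex.unionProd.pushoutObjObj A B
  rw [← Subcomplex.unionProd.pushoutObjObj_ι] at h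
  let t : s.pt ⟶ sHom D X := s.isPushout.desc (T.homEquiv _ _ u) (S.homEquiv _ _ v)
    ((S.homEquiv_comp_eHomWhiskerRight_map T u A.ι).symm.trans
      ((congrArg _ h₁).trans (S.homEquiv_comp _ v)))
  have ht₁ : s.inl ≫ t = T.homEquiv _ _ u := s.isPushout.inl_desc _ _ _
  have ht₂ : s.inr ≫ t = S.homEquiv _ _ v := s.isPushout.inr_desc _ _ _
  have sq : CommSq t s.ι (eHomWhiskerLeft SSet.{v} D p) (T.homEquiv _ _ w) := ⟨by
    apply s.isPushout.hom_ext
    · rw [s.inl_ι_assoc, reassoc_of% ht₁, ← Tensor.homEquiv_comp_eHomWhiskerLeft, h₂,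
        Tensor.homEquiv_comp]
      rfl
    · rw [s.inr_ι_assoc, reassoc_of% ht₂, ← Tensor.homEquiv_comp_eHomWhiskerLeft, h₃,
        Tensor.homEquiv_comp_eHomWhiskerRight_map]
      rfl⟩
  obtain ⟨⟨l₀, h₁, h₂⟩⟩ := h.sq_hasLift sq
  obtain ⟨l, hl⟩ := (T.homEquiv _ _).surjective l₀
  refine ⟨l, (T.homEquiv _ _).injective ?_, (S.homEquiv _ _).injective ?_,
    (T.homEquiv _ _).injective ?_⟩
  · rw [Tensor.homEquiv_comp, hl, ← ht₁, ← h₁]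
    exact (s.inl_ι_assoc l₀).symm
  · rw [Tensor.homEquiv_comp_eHomWhiskerRight_map, hl, ← ht₂, ← h₁]
    exact (s.inr_ι_assoc l₀).symm
  · rw [Tensor.homEquiv_comp_eHomWhiskerLeft, hl, h₂]

end

end SimplicialModel

/-! ### Lifting edges with prescribed ends -/

namespace SSet

open modelCategoryQuillen

lemma boundary.exists_desc {X : SSet.{v}} (x y : Δ[0] ⟶ X) :
    ∃ φ : (∂Δ[1] : SSet.{v}) ⟶ X, boundary.ι 0 ≫ φ = x ∧ boundary.ι 1 ≫ φ = y := by
  let t : (Λ[1, 0] : SSet.{v}) ⟶ Δ[0] := stdSimplex.isTerminalObj₀.from _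
  refine ⟨(boundary.isPushout 0).desc x (t ≫ y) boundary.hom_ext₀,
    (boundary.isPushout 0).inl_desc _ _ _, ?_⟩
  have : (boundary.ι 1 : Δ[0] ⟶ ∂Δ[1]) = horn.ι 0 1 (by simp) ≫ horn.toBoundary 1 := by
    rw [← cancel_mono (Subcomplex.ι _), boundary.ι_ι, Category.assoc]
    exact (horn.ι_ι 0 1 (by simp)).symm
  rw [this, Category.assoc, IsPushout.inr_desc, ← Category.assoc]
  exact (stdSimplex.isTerminalObj₀.hom_ext (_ ≫ t) (𝟙 _) =≫ y).trans (Category.id_comp y)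

lemma exists_edge_lift {E B : SSet.{v}} (q : E ⟶ B) [HasLiftingProperty (boundary.{v} 1).ι q]
    (x y : Δ[0] ⟶ E) (e : Δ[1] ⟶ B)
    (hx : const (stdSimplex.obj₀Equiv.symm 0) ≫ e = x ≫ q)
    (hy : const (stdSimplex.obj₀Equiv.symm 1) ≫ e = y ≫ q) :
    ∃ l : Δ[1] ⟶ E, const (stdSimplex.obj₀Equiv.symm 0) ≫ l = x ∧
      const (stdSimplex.obj₀Equiv.symm 1) ≫ l = y ∧ l ≫ q = e := by
  rw [← stdSimplex.δ_one_eq_const] at hx ⊢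
  rw [← stdSimplex.δ_zero_eq_const] at hy ⊢
  -- The order is reversed because the face `0` of `Δ[1]` is the vertex `1`.
  obtain ⟨φ, h₀, h₁⟩ := boundary.exists_desc y x
  have sq : CommSq φ ∂Δ[1].ι q e := ⟨boundary.hom_ext fun i ↦ by
    fin_cases i
    · exact ((Category.assoc _ _ _).symm.trans (h₀ =≫ q)).trans
        (hy.symm.trans (by rw [← boundary.ι_ι, Category.assoc]; rfl))
    · exact ((Category.assoc _ _ _).symm.trans (h₁ =≫ q)).trans
        (hx.symm.trans (by rw [← boundary.ι_ι, Category.assoc]; rfl))⟩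
  refine ⟨sq.lift, ?_, ?_, sq.fac_right⟩
  · rw [← boundary.ι_ι, Category.assoc, sq.fac_left, h₁]
  · rw [← boundary.ι_ι, Category.assoc, sq.fac_left, h₀]

end SSet

/-! ### Cell complexes and simplicial homotopies in a simplicial model category -/

namespace SimplicialModel

open SimplicialCategory SSet Limits Opposite CartesianMonoidalCategory modelCategoryQuillen

variable {M : Type u} [Category.{v} M] [SimplicialCategory M] [ModelCategory M]
  [SimplicialModelCategory M]

/-- A choice of the cotensor `Y^K`. -/
def cotensor (K : SSet.{v}) (Y : M) : Cotensor K Y :=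
  (SimplicialModelCategory.exists_cotensor K Y).some

section

variable {K L : SSet.{v}} {A B X Y : M} {j : K ⟶ L}

lemma hasEnrichedLifting_of_anodyneExtensions (hj : anodyneExtensions j) (i : A ⟶ B) (p : X ⟶ Y)
    [Cofibration i] [Fibration p] : HasEnrichedLifting j i p :=
  hasEnrichedLifting_of_hasLiftingProperty _ _ _
    (hj _ (SimplicialModelCategory.fibration i p))

lemma hasEnrichedLifting_of_trivialCofibration (j : K ⟶ L) [Mono j] (i : A ⟶ B) (p : X ⟶ Y)
    [Cofibration i] [WeakEquivalence i] [Fibration p] : HasEnrichedLifting j i p := by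
  have := SimplicialModelCategory.trivialFibration_of_left i p
  rw [trivialKanFibrations, ← rlp_monomorphisms] at this
  exact hasEnrichedLifting_of_hasLiftingProperty _ _ _ (this _ inferInstance)

lemma hasEnrichedLifting_of_trivialFibration (j : K ⟶ L) [Mono j] (i : A ⟶ B) (p : X ⟶ Y)
    [Cofibration i] [Fibration p] [WeakEquivalence p] : HasEnrichedLifting j i p := by
  have := SimplicialModelCategory.trivialFibration_of_right i p
  rw [trivialKanFibrations, ← rlp_monomorphisms] at this
  exact hasEnrichedLifting_of_hasLiftingProperty _ _ _ (this _ inferInstance)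

instance (D : M) [IsCofibrant D] (p : X ⟶ Y) [Fibration p] :
    Fibration (eHomWhiskerLeft SSet.{v} D p) := by
  rw [HomotopicalAlgebra.fibration_iff, fibrations_eq]
  intro _ _ j hj
  have hj' : anodyneExtensions j := fun _ _ _ hp ↦ hp _ hj
  exact (hasEnrichedLifting_of_anodyneExtensions hj' (initial.to D) p
    ).hasLiftingProperty_eHomWhiskerLeft (cotensor _ _) (cotensor _ _) (cotensor _ _)

lemma hasLiftingProperty_eHomWhiskerLeft_of_trivialFibration (j : K ⟶ L) [Mono j]
    (D : M) [IsCofibrant D] (p : X ⟶ Y) [Fibration p] [WeakEquivalence p] :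
    HasLiftingProperty j (eHomWhiskerLeft SSet.{v} D p) :=
  (hasEnrichedLifting_of_trivialFibration j (initial.to D) p
    ).hasLiftingProperty_eHomWhiskerLeft (cotensor _ _) (cotensor _ _) (cotensor _ _)

lemma hasLiftingProperty_eHomWhiskerRight_of_trivialCofibration (j : K ⟶ L) [Mono j]
    (i : A ⟶ B) [Cofibration i] [WeakEquivalence i] (X : M) [IsFibrant X] :
    HasLiftingProperty j (eHomWhiskerRight SSet.{v} i X) :=
  (hasEnrichedLifting_of_trivialCofibration j i (terminal.from X)
    ).hasLiftingProperty_eHomWhiskerRight (tensor _ _) (tensor _ _) (tensor _ _)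

instance (D Y : M) [IsCofibrant D] [IsFibrant Y] : KanComplex (sHom D Y) := by
  have (K : SSet.{v}) : Unique (K ⟶ sHom D (⊤_ M)) :=
    have := (tensor K D).subsingleton
    { default := (tensor K D).unit ≫ eHomWhiskerLeft SSet.{v} D (terminal.from _)
      uniq _ := by subsingleton }
  exact (isFibrant_iff_of_isTerminal (eHomWhiskerLeft SSet.{v} D (terminal.from Y))
    (IsTerminal.ofUnique _)).2 inferInstance

end

section

variable {𝒟 : ObjectProperty M} {X : M} {n : ℤ}

lemma DimLE.hasLiftingProperty (hX : DimLE.{w} 𝒟 X n) {E B : M} (q : E ⟶ B)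
    (hq : (cells 𝒟 n).rlp q) : HasLiftingProperty (initial.to X) q := by
  refine MorphismProperty.transfiniteCompositions_le_llp_rlp _ _ hX _ ?_
  rwa [MorphismProperty.rlp_pushouts]

/-- The bound `n + m` is the dimension of `Δ[k] ⊗ Δ[m]` for the largest cells, `k = n`. -/
lemma DimLE.hasEnrichedLifting (hX : DimLE.{w} 𝒟 X n) {E B : M} (p : E ⟶ B) (m : ℕ)
    (hp : ∀ D, 𝒟 D → ∀ k : ℕ, (k : ℤ) ≤ n + m →
      HasLiftingProperty ∂Δ[k].ι (eHomWhiskerLeft SSet.{v} D p)) :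
    HasEnrichedLifting ∂Δ[m].ι (initial.to X) p := by
  rw [hasEnrichedLifting_iff _ _ _ (cotensor _ _) (cotensor _ _) (cotensor _ _) (cotensor _ _)]
  apply hX.hasLiftingProperty
  rintro _ _ _ ⟨k, hk, D, hD⟩
  rw [← hasEnrichedLifting_iff]
  exact hasEnrichedLifting_map _ _ (hasLiftingProperty_of_hasDimensionLT _ (k + m + 1)
    (fun l hl ↦ hp D hD l (by lia)) _)

lemma DimLE.isCofibrant (hX : DimLE.{w} 𝒟 X n) (h𝒟 : ∀ D, 𝒟 D → IsCofibrant D) :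
    IsCofibrant X := by
  rw [isCofibrant_iff, HomotopicalAlgebra.cofibration_iff,
    ← MorphismProperty.llp_eq_of_wfs (cofibrations M) (trivialFibrations M)]
  intro _ _ p hp
  obtain ⟨_, _⟩ := (mem_trivialFibrations_iff p).1 hp
  refine (hX.hasEnrichedLifting p 0 fun D hD k _ ↦ ?_).hasLiftingProperty
  have := h𝒟 D hD
  exact hasLiftingProperty_eHomWhiskerLeft_of_trivialFibration _ D p

end

/-- Simplicial homotopies from `f` to `g`. -/
structure SimplicialHomotopy {X Y : M} (f g : X ⟶ Y) where
  h : Δ[1] ⟶ sHom X Y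
  h₀ : const (stdSimplex.obj₀Equiv.symm 0) ≫ h = constHom Δ[0] f
  h₁ : const (stdSimplex.obj₀Equiv.symm 1) ≫ h = constHom Δ[0] g

namespace SimplicialHomotopy

variable {X Y : M} {f g : X ⟶ Y}

/-- Simplicial homotopies induce equalities in the homotopy category. -/
lemma map_eq [IsCofibrant X] (H : SimplicialHomotopy f g) {C : Type*} [Category* C]
    (F : M ⥤ C) (hF : (weakEquivalences M).IsInvertedBy F) : F.map f = F.map g := by
  let T := tensor Δ[1] X
  choose i hi using fun ε : Fin 2 ↦
    exists_constHom_eq (const (stdSimplex.obj₀Equiv.symm ε) ≫ T.unit)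
  have hi' (ε : Fin 2) {Z : M} (h : Δ[1] ⟶ sHom X Z) :
      constHom Δ[0] (i ε ≫ T.desc h) = const (stdSimplex.obj₀Equiv.symm ε) ≫ h := by
    rw [← constHom_eHomWhiskerLeft, hi, Category.assoc, T.unit_desc]
  have h₀ : i 0 ≫ T.desc H.h = f := constHom_bijective.1 ((hi' _ _).trans H.h₀)
  have h₁ : i 1 ≫ T.desc H.h = g := constHom_bijective.1 ((hi' _ _).trans H.h₁)
  let π := T.desc (constHom Δ[1] (𝟙 X))
  have hπ (ε : Fin 2) : i ε ≫ π = 𝟙 X :=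
    constHom_bijective.1 ((hi' _ _).trans (by simp))
  -- Lifting `i 0` against a fibration `p` amounts to lifting a vertex of `Δ[1]` against the Kan
  -- fibration `map(X, p)`. Hence `F` inverts `i 0`, then its retraction `π`, and so identifies the
  -- two sections `i 0` and `i 1` of `π`.
  have hi₀ : trivialCofibrations M (i 0) := by
    rw [← MorphismProperty.llp_eq_of_wfs (trivialCofibrations M) (fibrations M)]
    intro E B p hp
    rw [← HomotopicalAlgebra.fibration_iff] at hp
    refine ⟨fun {a b} sq ↦ ?_⟩
    have : HasLiftingProperty (const (stdSimplex.obj₀Equiv.symm 0) : (Δ[0] : SSet.{v}) ⟶ Δ[1])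
      (eHomWhiskerLeft SSet.{v} X p) := anodyneExtensions_const 0 _ (by
        rw [← HomotopicalAlgebra.fibration_iff]
        infer_instance)
    have sq' : CommSq (constHom Δ[0] a) (const (stdSimplex.obj₀Equiv.symm 0))
        (eHomWhiskerLeft SSet.{v} X p) (T.unit ≫ eHomWhiskerLeft SSet.{v} X b) := ⟨by
      rw [constHom_eHomWhiskerLeft, sq.w, ← constHom_eHomWhiskerLeft, hi, Category.assoc]⟩
    refine ⟨⟨⟨T.desc sq'.lift, ?_, T.hom_ext ?_⟩⟩⟩
    · exact constHom_bijective.1 ((hi' _ _).trans sq'.fac_left)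
    · rw [eHomWhiskerLeft_comp, ← Category.assoc, T.unit_desc, sq'.fac_right]
  have := hF _ hi₀.2
  have hFπ (ε : Fin 2) : F.map (i ε) ≫ F.map π = 𝟙 _ := by rw [← F.map_comp, hπ, F.map_id]
  have : IsIso (F.map π) := by
    rw [← IsIso.inv_eq_of_hom_inv_id (hFπ 0)]
    infer_instance
  have : F.map (i 0) = F.map (i 1) := by rw [← cancel_mono (F.map π), hFπ, hFπ]
  calc
    F.map f = F.map (i 0) ≫ F.map (T.desc H.h) := by rw [← F.map_comp, h₀]
    _ = F.map g := by rw [this, ← F.map_comp, h₁]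

end SimplicialHomotopy

/-- Left homotopies induce simplicial homotopies if the target is fibrant. -/
lemma nonempty_simplicialHomotopy_of_leftHomotopyRel {X Y : M} [IsCofibrant X] [IsFibrant Y]
    {f g : X ⟶ Y} (H : LeftHomotopyRel f g) : Nonempty (SimplicialHomotopy f g) := by
  obtain ⟨P, _, ⟨h⟩⟩ := H.exists_good_cylinder
  have := hasLiftingProperty_eHomWhiskerRight_of_trivialCofibration (boundary.{v} 1).ι P.i₀ Y
  -- Both `P.π ≫ f` and `h.h` restrict to `f` along `P.i₀`, so the constant edge at `f` lifts to an
  -- edge joining them; restricted along `P.i₁`, it goes from `f` to `g`.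
  obtain ⟨l, h₀, h₁, -⟩ := exists_edge_lift (eHomWhiskerRight SSet.{v} P.i₀ Y)
    (constHom _ (P.π ≫ f)) (constHom _ h.h) (constHom _ f) (by simp) (by simp)
  exact ⟨{
    h := l ≫ eHomWhiskerRight SSet.{v} P.i₁ Y
    h₀ := by rw [reassoc_of% h₀]; simp
    h₁ := by rw [reassoc_of% h₁]; simp }⟩

/-- A trivial cofibration between fibrant objects is the inclusion of a deformation retract. -/
lemma exists_retraction {Y W : M} (s : Y ⟶ W) [Cofibration s] [WeakEquivalence s]
    [IsFibrant Y] [IsFibrant W] :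
    ∃ r : W ⟶ Y, Nonempty (SimplicialHomotopy (𝟙 W) (r ≫ s)) := by
  have sq : CommSq (𝟙 Y) s (terminal.from Y) (terminal.from W) := ⟨by subsingleton⟩
  have := hasLiftingProperty_eHomWhiskerRight_of_trivialCofibration (boundary.{v} 1).ι s W
  -- The identity and the retraction followed by `s` both restrict to `s` along `s`.
  obtain ⟨l, h₀, h₁, -⟩ := exists_edge_lift (eHomWhiskerRight SSet.{v} s W)
    (constHom _ (𝟙 W)) (constHom _ (sq.lift ≫ s)) (constHom _ s) (by simp) (by simp)
  exact ⟨sq.lift, ⟨{ h := l, h₀ := h₀, h₁ := h₁ }⟩⟩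

end SimplicialModel

/-! ### Passage to the homotopy category and the theorem -/

namespace SimplicialModel

open SimplicialCategory SSet Limits Opposite CartesianMonoidalCategory modelCategoryQuillen

section

variable {M : Type u} [Category.{v} M] [ModelCategory M]

lemma HomotopyClasses.postcomp_comp (X : M) {Y Z T : M} (f : Y ⟶ Z) (g : Z ⟶ T) :
    postcomp X (f ≫ g) = postcomp X g ∘ postcomp X f := by
  ext φ
  simp [postcomp]

lemma HomotopyClasses.postcomp_bijective (X : M) {Y Z : M} (f : Y ⟶ Z) [WeakEquivalence f] :
    Function.Bijective (postcomp X f) := by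
  have := (weakEquivalences M).Q_inverts f (mem_weakEquivalences f)
  exact (asIso ((weakEquivalences M).Q.map f)).homToEquiv.bijective

end

variable {M : Type u} [Category.{v} M] [SimplicialCategory M] [ModelCategory M]
  [SimplicialModelCategory M]

/-- Let `p` be a fibration whose restriction along a trivial cofibration `s` between fibrant
objects induces a `d`-equivalence on `map(D, -)`. Then `map(D, p)` lifts against the boundary
inclusions of simplices of dimension at most `d`. -/
lemma hasLiftingProperty_eHomWhiskerLeft_of_isDEquivalence {Y W Z : M} (s : Y ⟶ W) (p : W ⟶ Z)
    [Cofibration s] [WeakEquivalence s] [Fibration p] [IsFibrant Y] [IsFibrant Z]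
    (D : M) [IsCofibrant D] {d : ℤ}
    (h : SSet.IsDEquivalence d (eHomWhiskerLeft SSet.{v} D (s ≫ p))) (k : ℕ) (hk : (k : ℤ) ≤ d) :
    HasLiftingProperty ∂Δ[k].ι (eHomWhiskerLeft SSet.{v} D p) := by
  have : IsFibrant W := isFibrant_of_fibration p
  obtain ⟨r, ⟨H⟩⟩ := exists_retraction s
  rw [eHomWhiskerLeft_comp] at h
  exact SSet.IsDEquivalence.hasLiftingProperty (eHomWhiskerLeft SSet.{v} D s) _
    (eHomWhiskerLeft SSet.{v} D r) (sHom D W ◁ H.h ≫ sHomComp D W W) 0 1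
    ((ιEnd_whiskerLeft_sHomComp _ _ H.h₀ D).trans (eHomWhiskerLeft_id _ _ _))
    ((ιEnd_whiskerLeft_sHomComp _ _ H.h₁ D).trans (eHomWhiskerLeft_comp _ _ _ _))
    h k hk

/-- The case `m = 0`: a class into the fibrant `Z` is represented by a map, which lifts strictly
through `p`. -/
lemma DimLE.postcomp_surjective {𝒟 : ObjectProperty M} {n : ℤ} {X W Z : M}
    (hX : DimLE.{w} 𝒟 X n) (h𝒟 : ∀ D, 𝒟 D → IsCofibrant D) (p : W ⟶ Z) [IsFibrant Z]
    (hp : ∀ D, 𝒟 D → ∀ k : ℕ, (k : ℤ) ≤ n →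
      HasLiftingProperty ∂Δ[k].ι (eHomWhiskerLeft SSet.{v} D p)) :
    Function.Surjective (HomotopyClasses.postcomp X p) := by
  have := hX.isCofibrant h𝒟
  intro g
  obtain ⟨g, rfl⟩ := map_surjective_of_isLocalization (weakEquivalences M).Q X Z g
  have := (hX.hasEnrichedLifting p 0 (by simpa using hp)).hasLiftingProperty
  have sq : CommSq (initial.to W) (initial.to X) p g := ⟨by subsingleton⟩
  refine ⟨(weakEquivalences M).Q.map sq.lift, ?_⟩
  rw [HomotopyClasses.postcomp, ← Functor.map_comp, sq.fac_right]

/-- The case `m = 1`: a homotopy between the composites with `p` is an edge of `map(X, Z)`, which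
lifts to an edge of `map(X, W)` with the prescribed ends. -/
lemma DimLE.postcomp_injective {𝒟 : ObjectProperty M} {n : ℤ} {X W Z : M}
    (hX : DimLE.{w} 𝒟 X n) (h𝒟 : ∀ D, 𝒟 D → IsCofibrant D) (p : W ⟶ Z) [Fibration p]
    [IsFibrant Z] (hp : ∀ D, 𝒟 D → ∀ k : ℕ, (k : ℤ) ≤ n + 1 →
      HasLiftingProperty ∂Δ[k].ι (eHomWhiskerLeft SSet.{v} D p)) :
    Function.Injective (HomotopyClasses.postcomp X p) := by
  have := hX.isCofibrant h𝒟
  have : IsFibrant W := isFibrant_of_fibration p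
  intro f g h
  obtain ⟨f, rfl⟩ := map_surjective_of_isLocalization (weakEquivalences M).Q X W f
  obtain ⟨g, rfl⟩ := map_surjective_of_isLocalization (weakEquivalences M).Q X W g
  rw [HomotopyClasses.postcomp, HomotopyClasses.postcomp, ← Functor.map_comp,
    ← Functor.map_comp, ← LeftHomotopyRel.iff_map_eq] at h
  obtain ⟨H⟩ := nonempty_simplicialHomotopy_of_leftHomotopyRel h
  have := (hX.hasEnrichedLifting p 1 hp).hasLiftingProperty_eHomWhiskerLeft
    (cotensor _ _) (cotensor _ _) (cotensor _ _)
  obtain ⟨l, h₀, h₁, -⟩ := exists_edge_lift (eHomWhiskerLeft SSet.{v} X p)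
    (constHom _ f) (constHom _ g) H.h
    (by rw [H.h₀, constHom_eHomWhiskerLeft]) (by rw [H.h₁, constHom_eHomWhiskerLeft])
  exact SimplicialHomotopy.map_eq { h := l, h₀ := h₀, h₁ := h₁ } _
    (MorphismProperty.Q_inverts _)

/-- A `d`-equivalence is, up to weak equivalences, a fibration `p` between fibrant objects
such that the maps `map(D, p)` lift against the boundary inclusions of simplices of
dimension at most `d`. -/
lemma IsDEquivalence.exists_fibration {𝒟 : ObjectProperty M} (h𝒟 : ∀ D, 𝒟 D → IsCofibrant D)
    {d : ℤ} {Y Z : M} {f : Y ⟶ Z} (hf : IsDEquivalence 𝒟 d f) :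
    ∃ (W Z' : M) (i : Y ⟶ W) (j : Z ⟶ Z') (p : W ⟶ Z'), WeakEquivalence i ∧ WeakEquivalence j ∧
      Fibration p ∧ IsFibrant Z' ∧ f ≫ j = i ≫ p ∧ ∀ D, 𝒟 D → ∀ k : ℕ, (k : ℤ) ≤ d →
        HasLiftingProperty ∂Δ[k].ι (eHomWhiskerLeft SSet.{v} D p) := by
  obtain ⟨Y', Z', i, j, f', _, _, _, _, fac, hf'⟩ := hf
  let φ := MorphismProperty.factorizationData (trivialCofibrations M) (fibrations M) f'
  refine ⟨φ.Z, Z', i ≫ φ.i, j, φ.p, inferInstance, inferInstance, inferInstance, inferInstance,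
    by simp [fac], fun D hD k hk ↦ ?_⟩
  have := h𝒟 D hD
  have h := hf' D hD
  rw [← φ.fac] at h
  exact hasLiftingProperty_eHomWhiskerLeft_of_isDEquivalence _ _ D h k hk

end SimplicialModel

end

theorem mainTheorem3 {M : Type u} [Category.{v} M] [SimplicialCategory M] [ModelCategory M]
    [SimplicialModel.SimplicialModelCategory M]
    (𝒟 : ObjectProperty M) (h𝒟 : ∀ D, 𝒟 D → IsCofibrant D)
    (d : ℤ) (X Y Z : M) (f : Y ⟶ Z) (hf : SimplicialModel.IsDEquivalence 𝒟 d f) :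
    (SimplicialModel.DimLE.{w} 𝒟 X d →
      Function.Surjective (SimplicialModel.HomotopyClasses.postcomp X f)) ∧
    (SimplicialModel.DimLT.{w} 𝒟 X d →
      Function.Bijective (SimplicialModel.HomotopyClasses.postcomp X f)) := by
  open SimplicialModel HomotopyClasses in
  obtain ⟨W, Z', i, j, p, _, _, _, _, fac, hp⟩ := hf.exists_fibration h𝒟
  have hi := postcomp_bijective X i
  have hj := postcomp_bijective X j
  have hfac : postcomp X j ∘ postcomp X f = postcomp X p ∘ postcomp X i := by
    rw [← postcomp_comp, ← postcomp_comp, fac]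
  refine ⟨fun hX ↦ ?_, ?_⟩
  · rw [← Function.Surjective.of_comp_iff' hj, hfac]
    exact (hX.postcomp_surjective h𝒟 p hp).comp hi.2
  · rintro ⟨n, hn, hX⟩
    rw [← Function.Bijective.of_comp_iff' hj, hfac]
    -- Injectivity needs lifting up to dimension `n + 1`, which `n < d` allows.
    exact Function.Bijective.comp ⟨hX.postcomp_injective h𝒟 p fun D hD k hk ↦ hp D hD k (by lia),
      hX.postcomp_surjective h𝒟 p fun D hD k hk ↦ hp D hD k (by lia)⟩ hi
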